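/- For $\epsilon\in(0,1/2)$ let $b=\sqrt{\epsilon}$, let $a$ be determined by $(1-\epsilon)a+\epsilon b=1/2$, and let $\mu$ be the probability density on $[-1,1]$ with $\mu=b$ on $[-\epsilon,\epsilon]$ and $\mu=a$ on $[-1,-\epsilon)\cup(\epsilon,1]$. Let $f^*(x)=-1$ on $[-1,-\epsilon)$, $f^*(x)=x/\epsilon$ on $[-\epsilon,\epsilon]$ and $f^*(x)=1$ on $(\epsilon,1]$. Let $$\mathcal H=\Big\{f:[-1,1]\to\mathbb R \text{ absolutely continuous, odd, } \|f\|_{\mathcal H}^2:=\int_{-1}^1 f'(x)^2\mu^2(x)\,dx<\infty\Big\},$$ $$\mathcal L=\Big\{f:[-1,1]\to\mathbb R \text{ absolutely continuous, odd, } \|f\|_{\mathcal L}:=\operatorname{ess\,sup}_{|x|\le1}|f'(x)|<\infty\Big\}.$$ Draw $n\ge1$ points $x_1,\dots,x_n$ independently from $\mu$ and observe $y_i=f^*(x_i)+\sigma\xi_i$, where $\sigma>0$ and the $\xi_i$ are i.i.d. standard normal, independent of the $x_i$. Let $\widehat f_{\mathcal H}$ be a minimizer of $\frac1n\sum_{i=1}^n(y_i-f(x_i))^2$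 over $\{f\in\mathcal H:\|f\|_{\mathcal H}\le2\}$, let $\widehat f_{\mathcal L}$ be a minimizer of the same criterion over $\{f\in\mathcal L:\|f\|_{\mathcal L}\le1/\epsilon\}$, and write $\|f\|_n^2=\frac1n\sum_{i=1}^nf(x_i)^2$. **Theorem 3.** There are universal constants $c_0,c_1,c_2,c_3>0$ such that, for all $\epsilon\in(0,1/2)$, $\sigma>0$ and $n\ge1$, such minimizers exist almost surely, every choice of $\widehat f_{\mathcal H}$ satisfies $$\|\widehat f_{\mathcal H}-f^*\|_n^2\le c_1\Big(\frac{\sigma^2}{n}\Big)^{2/3}\quad\text{with probability at least } 1-\exp\Big\{-c_0\Big(\frac n{\sigma^2}\Big)^{1/3}\Big\},$$ and every choice of $\widehat f_{\mathcal L}$ satisfies $$\|\widehat f_{\mathcal L}-f^*\|_n^2\le c_3\Big(\frac{\sigma^2}{\epsilon n}\Big)^{2/3}\quad\text{with probability at least } 1-\exp\Big\{-c_2\Big(\epsilon^2\frac n{\sigma^2}\Big)^{1/3}\Big\}.$$ -/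

import Mathlib

open MeasureTheory ProbabilityTheory Set

noncomputable section

/-- The value of the density near the origin, `b = √ε`. -/
def densB (ε : ℝ) : ℝ := Real.sqrt ε

/-- The value of the density away from the origin, determined by `(1 - ε) a + ε b = 1 / 2`. -/
def densA (ε : ℝ) : ℝ := (1 / 2 - ε * densB ε) / (1 - ε)

/-- The density on `[-1, 1]`: it equals `b` on `[-ε, ε]` and `a` on the rest of `[-1, 1]`. -/
def dens (ε x : ℝ) : ℝ :=
  if |x| ≤ ε then densB ε else if |x| ≤ 1 then densA ε else 0

/-- The distribution of a design point. -/
def designLaw (ε : ℝ) : Measure ℝ :=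
  volume.withDensity (fun x => ENNReal.ofReal (dens ε x))

/-- The regression function: `-1`, then a ramp of slope `1 / ε` on `[-ε, ε]`, then `1`. -/
def ramp (ε x : ℝ) : ℝ :=
  if x < -ε then -1 else if x ≤ ε then x / ε else 1

/-- Odd, absolutely continuous functions on `[-1, 1]` (values outside `[-1, 1]` play no role).
Such a function has a derivative at almost every point of `[-1, 1]`. -/
def IsOddAC (f : ℝ → ℝ) : Prop :=
  AbsolutelyContinuousOnInterval f (-1) 1 ∧ ∀ x ∈ Icc (-1 : ℝ) 1, f (-x) = -f x

/-- The weighted Sobolev space: odd absolutely continuous functions with `∫ f'² μ² < ∞`. -/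
def sobolevSpace (ε : ℝ) : Set (ℝ → ℝ) :=
  {f | IsOddAC f ∧ IntegrableOn (fun x => deriv f x ^ 2 * dens ε x ^ 2) (Icc (-1) 1)}

/-- The norm `(∫ f'² μ²)^(1/2)` of the weighted Sobolev space. -/
def sobolevNorm (ε : ℝ) (f : ℝ → ℝ) : ℝ :=
  Real.sqrt (∫ x in Icc (-1 : ℝ) 1, deriv f x ^ 2 * dens ε x ^ 2)

/-- The (essential) supremum of `|f'|` on `[-1, 1]`, as an extended number. -/
def lipENorm (f : ℝ → ℝ) : ENNReal :=
  eLpNorm (deriv f) ⊤ (volume.restrict (Icc (-1) 1))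

/-- The odd absolutely continuous functions with `sup |f'| < ∞`. -/
def lipSpace : Set (ℝ → ℝ) := {f | IsOddAC f ∧ lipENorm f < ⊤}

/-- The norm `sup |f'|`. -/
def lipNorm (f : ℝ → ℝ) : ℝ := (lipENorm f).toReal

/-- The ball of radius `2` in the weighted Sobolev space. -/
def sobolevBall (ε : ℝ) : Set (ℝ → ℝ) := {f | f ∈ sobolevSpace ε ∧ sobolevNorm ε f ≤ 2}

/-- The ball of radius `1 / ε` for the norm `sup |f'|`. -/
def lipBall (ε : ℝ) : Set (ℝ → ℝ) := {f | f ∈ lipSpace ∧ lipNorm f ≤ 1 / ε}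

/-- The squared empirical norm `(1 / n) ∑ g(x_i)²`. -/
def empNormSq {n : ℕ} (x : Fin n → ℝ) (g : ℝ → ℝ) : ℝ :=
  (1 / (n : ℝ)) * ∑ i, g (x i) ^ 2

/-- The least-squares criterion `(1 / n) ∑ (y_i - f(x_i))²`. -/
def empLoss {n : ℕ} (x y : Fin n → ℝ) (f : ℝ → ℝ) : ℝ :=
  (1 / (n : ℝ)) * ∑ i, (y i - f (x i)) ^ 2

/-- `f` is a least-squares estimator over the class `C`, for the data `(x_i, y_i)`. -/
def IsLeastSquares {n : ℕ} (C : Set (ℝ → ℝ)) (x y : Fin n → ℝ) (f : ℝ → ℝ) : Prop :=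
  f ∈ C ∧ IsMinOn (empLoss x y) C f

/-- The responses `y_i = f*(x_i) + σ ξ_i`. -/
def response {n : ℕ} (ε σ : ℝ) (x ξ : Fin n → ℝ) (i : Fin n) : ℝ :=
  ramp ε (x i) + σ * ξ i

/-- The sampling model: the design points are i.i.d. with density `dens ε`, the noise variables
are i.i.d. standard normal, and the noise is independent of the design. -/
structure IsSample {Ω : Type*} [MeasurableSpace Ω] (P : Measure Ω) (ε : ℝ) {n : ℕ}
    (X ξ : Fin n → Ω → ℝ) : Prop where
  law_design : ∀ i, HasLaw (X i) (designLaw ε) P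
  law_noise : ∀ i, HasLaw (ξ i) (gaussianReal 0 1) P
  indep_design : iIndepFun X P
  indep_noise : iIndepFun ξ P
  indep : IndepFun (fun ω i => X i ω) (fun ω i => ξ i ω) P

end

/-!
Both classes are images of Hilbert balls: an odd absolutely continuous `f` satisfies
`f x = ∫_0^x f' = ⟪f' p, k x⟫` in `L²[-1, 1]`, with `k x = (1_{t ≤ x} - 1_{t ≤ 0}) / p`, for any
weight `p`. The weight `p = dens ε` turns the Sobolev ball into a ball of radius `2`. The Lipschitz
ball is contained in the ball of radius `√2 / ε` for the weight `p = 1`. Moreover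
`‖k x - k y‖² = |s x - s y|` for an increasing function `s`, so up to a change of the
variable `x` the class is a ball of the unweighted first-order Sobolev space on an interval of
length `L = ∫ p⁻²`, and `L` is bounded uniformly in `ε` (`integral_inv_dens_sq_le`).

Fix the design. By the basic inequality of least squares and by scaling, an estimator with error
larger than `t` in empirical norm yields `g` with `‖g‖ ≤ r`, `∑ ⟪g, k (x i)⟫² ≤ n t²` and
`∑ ξ i ⟪g, k (x i)⟫ ≥ n t² / (4 σ)`. No chaining is needed to bound the supremum of
this Gaussian process, because the set of the vectors `(⟪g, k (x i)⟫)_i` lies in an ellipsoid: if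
`l j` are the eigenvalues of the Gram matrix and `a = n t²`, its squared axes are twice the parallel
sums of `a` and `r² l j` (`sq_sum_mul_inner_le`). They are at most `2 a`, and their sum is
controlled by splitting the coordinate vectors into their averages over cells of `s`-length `h`
and the rest: the averages cost `a` per cell, the rest costs `r² h` per point (`sum_parSum_le`).
With the optimal `h` the total is of order `n t B`, where `B = r √L`, and a Chernoff bound for
Gaussian quadratic forms gives the tail `exp (-c n t² / σ²)` as soon as `t³` exceeds a multiple of
`B σ² / n`. When `t > B` the event is null, since `|⟪g, k x⟫| ≤ B`. The random design is handled by
Fubini. The measurability this takes comes from writing the bad event as a union of open sets.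

Least squares solutions exist because the vectors of values at the design points form a compact
set. For the Sobolev ball it is the image of a Hilbert ball under finitely many inner products, and
the ball may be replaced by its projection to a finite-dimensional space. For the Lipschitz ball
it is cut out by finitely many closed conditions, by extension of Lipschitz functions.
-/

/-! ### Tails of Gaussian quadratic forms -/

theorem integrable_exp_mul_sq_gaussianReal {s : ℝ} (hs : s < 1 / 2) :
    Integrable (fun x => Real.exp (s * x ^ 2)) (gaussianReal 0 1) := by
  rw [gaussianReal_of_var_ne_zero _ one_ne_zero,
    integrable_withDensity_iff (measurable_gaussianPDF 0 1) (by simp [gaussianPDF])]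
  have := (integrable_exp_neg_mul_sq (b := 1 / 2 - s) (by linarith)).const_mul
    (√(2 * Real.pi))⁻¹
  refine this.congr (Filter.Eventually.of_forall fun x => ?_)
  simp only [toReal_gaussianPDF, gaussianPDFReal_def, NNReal.coe_one, mul_one, sub_zero]
  rw [mul_comm (Real.exp (s * x ^ 2)), mul_assoc, ← Real.exp_add]
  ring_nf

/-- The exact value is `(1 - 2 s) ^ (-1 / 2)`. -/
theorem integral_exp_mul_sq_gaussianReal_le {s : ℝ} (h0 : 0 ≤ s) (hs : s ≤ 1 / 4) :
    ∫ x, Real.exp (s * x ^ 2) ∂(gaussianReal 0 1) ≤ Real.exp (2 * s) := by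
  rw [integral_gaussianReal_eq_integral_smul one_ne_zero]
  have : ∀ x : ℝ, gaussianPDFReal 0 1 x • Real.exp (s * x ^ 2)
      = (√(2 * Real.pi))⁻¹ * Real.exp (-(1 / 2 - s) * x ^ 2) := by
    intro x
    simp only [gaussianPDFReal_def, NNReal.coe_one, mul_one, sub_zero, smul_eq_mul]
    rw [mul_assoc, ← Real.exp_add]
    ring_nf
  simp_rw [this]
  rw [integral_const_mul, integral_gaussian, ← Real.sqrt_inv, ← Real.sqrt_mul (by positivity)]
  have hpi := Real.pi_pos
  have h1 : (2 * Real.pi)⁻¹ * (Real.pi / (1 / 2 - s)) = (1 - 2 * s)⁻¹ := by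
    have : (1 - 2 * s) ≠ 0 := by linarith
    have : (1 / 2 - s) ≠ 0 := by linarith
    field_simp
  rw [h1]
  apply Real.sqrt_le_iff.2 ⟨(Real.exp_pos _).le, ?_⟩
  rw [← Real.exp_nat_mul]
  apply inv_le_of_inv_le₀ (Real.exp_pos _)
  rw [← Real.exp_neg]
  -- `exp (-4 s) ≤ 1 / (1 + 4 s) ≤ 1 - 2 s` for `s ≤ 1 / 4`
  have h2 : (1 + 4 * s) ≤ Real.exp (4 * s) := by linarith [Real.add_one_le_exp (4 * s)]
  have h3 : Real.exp (-(4 * s)) ≤ (1 + 4 * s)⁻¹ := by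
    rw [Real.exp_neg]; exact inv_anti₀ (by linarith) h2
  have h4 : (1 + 4 * s)⁻¹ ≤ 1 - 2 * s := by
    rw [inv_le_iff_one_le_mul₀ (by linarith)]; nlinarith
  push_cast
  calc Real.exp (-(2 * (2 * s))) = Real.exp (-(4 * s)) := by ring_nf
    _ ≤ _ := h3.trans h4

/-- Chernoff bound for a diagonal quadratic form `∑ N j z j ^ 2`. -/
theorem measureReal_pi_gaussian_quadratic_le {n : ℕ} {N : Fin n → ℝ} {a : ℝ} (ha : 0 < a)
    (hN0 : ∀ j, 0 ≤ N j) (hNa : ∀ j, N j ≤ a) (v : ℝ) :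
    (Measure.pi fun _ : Fin n => gaussianReal 0 1).real {z | v ≤ ∑ j, N j * z j ^ 2}
      ≤ Real.exp (-(v / (4 * a)) + (∑ j, N j) / (2 * a)) := by
  set γ := (Measure.pi fun _ : Fin n => gaussianReal 0 1)
  have hs : ∀ j, N j / (4 * a) ≤ 1 / 4 := fun j => by
    rw [div_le_iff₀ (by positivity)]; linarith [hNa j]
  have hexp : ∀ z : Fin n → ℝ, Real.exp (1 / (4 * a) * ∑ j, N j * z j ^ 2)
      = ∏ j, Real.exp (N j / (4 * a) * z j ^ 2) := by
    intro z
    rw [← Real.exp_sum, Finset.mul_sum]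
    congr 1
    exact Finset.sum_congr rfl fun j _ => by ring
  have hint : Integrable (fun z : Fin n → ℝ => Real.exp (1 / (4 * a) * ∑ j, N j * z j ^ 2)) γ := by
    simp_rw [hexp]
    exact Integrable.fintype_prod (f := fun j x => Real.exp (N j / (4 * a) * x ^ 2))
      fun j => integrable_exp_mul_sq_gaussianReal (by linarith [hs j])
  refine (measure_ge_le_exp_mul_mgf v (t := 1 / (4 * a)) (by positivity) hint).trans ?_
  have hmgf : mgf (fun z : Fin n → ℝ => ∑ j, N j * z j ^ 2) γ (1 / (4 * a))
      ≤ Real.exp ((∑ j, N j) / (2 * a)) := by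
    rw [mgf]
    simp_rw [hexp]
    rw [integral_fintype_prod_eq_prod (f := fun j x => Real.exp (N j / (4 * a) * x ^ 2))]
    have : Real.exp ((∑ j, N j) / (2 * a)) = ∏ j, Real.exp (2 * (N j / (4 * a))) := by
      rw [← Real.exp_sum, Finset.sum_div]
      congr 1
      exact Finset.sum_congr rfl fun j _ => by ring
    rw [this]
    exact Finset.prod_le_prod (fun j _ => integral_nonneg fun x => (Real.exp_pos _).le)
      fun j _ => integral_exp_mul_sq_gaussianReal_le (div_nonneg (hN0 j) (by positivity)) (hs j)
  rw [Real.exp_add]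
  have : -(1 / (4 * a)) * v = -(v / (4 * a)) := by ring
  rw [this]
  gcongr

/-- By rotation invariance the Chernoff bound holds for a form that is diagonal in any
orthonormal basis. -/
theorem measure_pi_gaussian_quadratic_basis_le {n : ℕ} {N : Fin n → ℝ} {a : ℝ} (ha : 0 < a)
    (hN0 : ∀ j, 0 ≤ N j) (hNa : ∀ j, N j ≤ a) (v : ℝ)
    (b : OrthonormalBasis (Fin n) ℝ (EuclideanSpace ℝ (Fin n))) :
    (Measure.pi fun _ : Fin n => gaussianReal 0 1)
        {ξ | v ≤ ∑ j, N j * inner ℝ (b j) (WithLp.toLp 2 ξ) ^ 2}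
      ≤ ENNReal.ofReal (Real.exp (-(v / (4 * a)) + (∑ j, N j) / (2 * a))) := by
  set S : Set (EuclideanSpace ℝ (Fin n)) := {y | v ≤ ∑ j, N j * inner ℝ (b j) y ^ 2}
  have hS : MeasurableSet S := measurableSet_le measurable_const (by fun_prop)
  have h1 : (Measure.pi fun _ : Fin n => gaussianReal 0 1)
        {ξ | v ≤ ∑ j, N j * inner ℝ (b j) (WithLp.toLp 2 ξ) ^ 2}
      = stdGaussian (EuclideanSpace ℝ (Fin n)) S := by
    rw [← map_pi_eq_stdGaussian, Measure.map_apply (by fun_prop) hS]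
    rfl
  rw [h1, stdGaussian_eq_map_pi_orthonormalBasis b, Measure.map_apply (by fun_prop) hS]
  have h2 : (fun x : Fin n → ℝ => ∑ i, x i • b i) ⁻¹' S
      = {z : Fin n → ℝ | v ≤ ∑ j, N j * z j ^ 2} := by
    ext z
    have : ∀ j, inner ℝ (b j) (∑ i, z i • b i) = z j := fun j => by
      simp [inner_sum, inner_smul_right, b.inner_eq_ite]
    simp only [S, mem_preimage, mem_ofPred_eq, this]
  rw [h2, ← ofReal_measureReal]
  exact ENNReal.ofReal_le_ofReal (measureReal_pi_gaussian_quadratic_le ha hN0 hNa v)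

/-! ### Gaussian width of a localized ball -/

section Width

variable {H : Type*} [NormedAddCommGroup H] [InnerProductSpace ℝ H] {n : ℕ}

/-- Spectral decomposition of the Gram matrix of a finite family of vectors. -/
theorem exists_basis_norm_sum_smul_sq (k : Fin n → H) :
    ∃ (b : OrthonormalBasis (Fin n) ℝ (EuclideanSpace ℝ (Fin n))) (l : Fin n → ℝ),
      (∀ j, 0 ≤ l j) ∧ ∀ y : EuclideanSpace ℝ (Fin n),
        ‖∑ i, y i • k i‖ ^ 2 = ∑ j, l j * inner ℝ (b j) y ^ 2 := by
  have hG := Matrix.posSemidef_gram ℝ k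
  refine ⟨hG.1.eigenvectorBasis, hG.1.eigenvalues, hG.eigenvalues_nonneg, fun y => ?_⟩
  set b := hG.1.eigenvectorBasis
  have h1 : ‖∑ i, y i • k i‖ ^ 2 = inner ℝ y (WithLp.toLp 2 ((Matrix.gram ℝ k).mulVec y.ofLp)) := by
    rw [← real_inner_self_eq_norm_sq, ← Matrix.star_dotProduct_gram_mulVec (𝕜 := ℝ),
      EuclideanSpace.inner_eq_star_dotProduct, dotProduct_comm]
  have h2 : ∀ j, inner ℝ (b j) (WithLp.toLp 2 ((Matrix.gram ℝ k).mulVec y.ofLp))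
      = hG.1.eigenvalues j * inner ℝ (b j) y := by
    intro j
    have h3 := hG.1.mulVec_eigenvectorBasis j
    rw [EuclideanSpace.inner_eq_star_dotProduct, EuclideanSpace.inner_eq_star_dotProduct]
    simp only [star_trivial]
    rw [dotProduct_comm, Matrix.dotProduct_mulVec, ← Matrix.mulVec_transpose]
    have h4 : (Matrix.gram ℝ k).transpose = Matrix.gram ℝ k := by
      ext i j; simp [Matrix.gram, real_inner_comm]
    rw [h4, h3, smul_dotProduct, smul_eq_mul, dotProduct_comm]
  rw [h1, ← b.sum_inner_mul_inner]
  refine Finset.sum_congr rfl fun j _ => ?_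
  rw [h2, real_inner_comm]
  ring

/-- The parallel sum `a l / (a + l)` of two weights. -/
noncomputable def parSum (a l : ℝ) : ℝ := a * l / (a + l)

theorem parSum_nonneg {a l : ℝ} (ha : 0 < a) (hl : 0 ≤ l) : 0 ≤ parSum a l := by
  unfold parSum; positivity

theorem parSum_le_left {a l : ℝ} (ha : 0 < a) (hl : 0 ≤ l) : parSum a l ≤ a := by
  unfold parSum
  rw [div_le_iff₀ (by positivity)]
  nlinarith

/-- The parallel sum is the optimal value of the splitting problem `min (a x² + l y²)` over
`x + y = 1`. -/
theorem parSum_mul_sq_le {a l : ℝ} (ha : 0 < a) (hl : 0 ≤ l) (x y : ℝ) :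
    parSum a l * (x + y) ^ 2 ≤ a * x ^ 2 + l * y ^ 2 := by
  unfold parSum
  rw [div_mul_eq_mul_div, div_le_iff₀ (by positivity)]
  nlinarith [sq_nonneg (a * x - l * y)]

/-- The vectors `(⟪g, k i⟫)_i` with `‖g‖ ≤ r` and `∑ ⟪g, k i⟫² ≤ a` lie in an ellipsoid with
squared axes `2 * parSum a (r² l j)`. -/
theorem sq_sum_mul_inner_le {k : Fin n → H}
    {b : OrthonormalBasis (Fin n) ℝ (EuclideanSpace ℝ (Fin n))} {l : Fin n → ℝ}
    (hl : ∀ j, 0 ≤ l j)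
    (hb : ∀ y : EuclideanSpace ℝ (Fin n), ‖∑ i, y i • k i‖ ^ 2 = ∑ j, l j * inner ℝ (b j) y ^ 2)
    {a r : ℝ} (ha : 0 < a) (ξ : EuclideanSpace ℝ (Fin n)) {g : H} (hg : ‖g‖ ≤ r)
    (hga : ∑ i, inner ℝ g (k i) ^ 2 ≤ a) :
    (∑ i, ξ i * inner ℝ g (k i)) ^ 2
      ≤ 2 * ∑ j, parSum a (r ^ 2 * l j) * inner ℝ (b j) ξ ^ 2 := by
  have hpos : ∀ j, 0 < a + r ^ 2 * l j := fun j => by have := hl j; positivity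
  -- the optimal splitting `ξ = x + (ξ - x)`
  set x : EuclideanSpace ℝ (Fin n) :=
    ∑ j, (r ^ 2 * l j / (a + r ^ 2 * l j) * inner ℝ (b j) ξ) • b j
  have hx : ∀ j, inner ℝ (b j) x = r ^ 2 * l j / (a + r ^ 2 * l j) * inner ℝ (b j) ξ := fun j => by
    simp [x, inner_sum, inner_smul_right, b.inner_eq_ite]
  have hy : ∀ j, inner ℝ (b j) (ξ - x) = a / (a + r ^ 2 * l j) * inner ℝ (b j) ξ := fun j => by
    rw [inner_sub_right, hx]
    have := (hpos j).ne'
    field_simp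
    ring
  have hxn : ‖x‖ ^ 2 = ∑ j, inner ℝ (b j) x ^ 2 := by
    rw [← b.sum_sq_norm_inner_right x]; simp
  set p := ∑ i, x i * inner ℝ g (k i)
  set q := ∑ i, (ξ - x) i * inner ℝ g (k i)
  have hpq : ∑ i, ξ i * inner ℝ g (k i) = p + q := by
    rw [← Finset.sum_add_distrib]
    refine Finset.sum_congr rfl fun i _ => ?_
    rw [PiLp.sub_apply]; ring
  have hp : p ^ 2 ≤ a * ‖x‖ ^ 2 := by
    have h1 := Finset.sum_mul_sq_le_sq_mul_sq Finset.univ (fun i => x i) fun i => inner ℝ g (k i)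
    have h2 : ∑ i, x i ^ 2 = ‖x‖ ^ 2 := by rw [EuclideanSpace.norm_sq_eq]; simp
    rw [h2] at h1
    nlinarith [sq_nonneg ‖x‖]
  have hq : q ^ 2 ≤ r ^ 2 * ‖∑ i, (ξ - x) i • k i‖ ^ 2 := by
    have h1 : q = inner ℝ g (∑ i, (ξ - x) i • k i) := by
      simp [q, inner_sum, inner_smul_right]
    rw [h1, ← mul_pow, ← sq_abs]
    gcongr
    exact (abs_real_inner_le_norm _ _).trans (by gcongr)
  rw [hpq]
  have h3 : ∑ j, parSum a (r ^ 2 * l j) * inner ℝ (b j) ξ ^ 2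
      = a * ‖x‖ ^ 2 + r ^ 2 * ‖∑ i, (ξ - x) i • k i‖ ^ 2 := by
    rw [hb, hxn, Finset.mul_sum, Finset.mul_sum, ← Finset.sum_add_distrib]
    refine Finset.sum_congr rfl fun j _ => ?_
    rw [hx, hy, parSum]
    have := (hpos j).ne'
    field_simp
    ring
  rw [h3]
  nlinarith [sq_nonneg (p - q)]

/-- The trace bound: the part of each coordinate vector that is constant on cells costs `a` per
cell, and the rest costs `r² h` per point. -/
theorem sum_parSum_le {κ : Type*} [Fintype κ] [DecidableEq κ] {k : Fin n → H} {c : Fin n → κ}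
    {h : ℝ} (hc : ∀ i j, c i = c j → ‖k i - k j‖ ^ 2 ≤ h)
    {b : OrthonormalBasis (Fin n) ℝ (EuclideanSpace ℝ (Fin n))} {l : Fin n → ℝ}
    (hl : ∀ j, 0 ≤ l j)
    (hb : ∀ y : EuclideanSpace ℝ (Fin n), ‖∑ i, y i • k i‖ ^ 2 = ∑ j, l j * inner ℝ (b j) y ^ 2)
    {a : ℝ} (ha : 0 < a) (r : ℝ) :
    ∑ j, parSum a (r ^ 2 * l j) ≤ a * Fintype.card κ + r ^ 2 * (n * h) := by
  let s : Fin n → Finset (Fin n) := fun i => Finset.univ.filter fun j => c j = c i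
  have hs : ∀ i, i ∈ s i := fun i => by simp [s]
  have hm : ∀ i, (0 : ℝ) < (s i).card := fun i => by
    exact_mod_cast Finset.card_pos.2 ⟨i, hs i⟩
  let e : Fin n → EuclideanSpace ℝ (Fin n) := fun i => EuclideanSpace.single i 1
  -- the projection of the coordinate vector `e i` onto the vectors that are constant on cells
  let x : Fin n → EuclideanSpace ℝ (Fin n) := fun i => ((s i).card : ℝ)⁻¹ • ∑ j ∈ s i, e j
  have hxj : ∀ i j, x i j = if c j = c i then ((s i).card : ℝ)⁻¹ else 0 := by
    intro i j
    simp [x, e, s, Finset.sum_apply, Pi.single_apply]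
  have hxn : ∀ i, ‖x i‖ ^ 2 = ((s i).card : ℝ)⁻¹ := by
    intro i
    rw [EuclideanSpace.norm_sq_eq]
    simp only [hxj, Real.norm_eq_abs, sq_abs, ite_pow]
    rw [Finset.sum_ite]
    simp only [Finset.sum_const, nsmul_eq_mul]
    have := (hm i).ne'
    change ((s i).card : ℝ) * _ + _ = _
    field_simp
    simp
  have hrest : ∀ i, ‖∑ j, (e i - x i) j • k j‖ ^ 2 ≤ h := by
    intro i
    have h1 : ∑ j, (e i - x i) j • k j = ((s i).card : ℝ)⁻¹ • ∑ j ∈ s i, (k i - k j) := by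
      have h2 : ∑ j, (e i) j • k j = k i := by
        simp [e]
      have h3 : ∑ j, (x i) j • k j = ((s i).card : ℝ)⁻¹ • ∑ j ∈ s i, k j := by
        simp only [hxj, ite_smul, zero_smul]
        rw [← Finset.sum_filter, Finset.smul_sum]
      simp only [PiLp.sub_apply, sub_smul, Finset.sum_sub_distrib]
      rw [h2, h3, smul_sub]
      simp only [Finset.sum_const, ← Nat.cast_smul_eq_nsmul ℝ]
      rw [smul_smul, inv_mul_cancel₀ (hm i).ne', one_smul]
    have h0 : 0 ≤ h := by
      have := hc i i rfl
      simpa using this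
    have h4 : ‖((s i).card : ℝ)⁻¹ • ∑ j ∈ s i, (k i - k j)‖ ≤ √h := by
      rw [norm_smul, norm_inv, Real.norm_natCast, inv_mul_le_iff₀ (hm i)]
      refine (norm_sum_le _ _).trans ?_
      refine (Finset.sum_le_card_nsmul _ _ (√h) fun j hj => ?_).trans (by simp)
      exact Real.le_sqrt_of_sq_le (hc i j (by simpa [s, eq_comm] using hj))
    rw [h1]
    calc _ ≤ √h ^ 2 := by gcongr
      _ = h := Real.sq_sqrt h0
  have hcard : ∑ i, ((s i).card : ℝ)⁻¹ ≤ Fintype.card κ := by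
    rw [← Finset.sum_fiberwise Finset.univ c]
    have : (Fintype.card κ : ℝ) = ∑ _q : κ, (1 : ℝ) := by simp
    rw [this]
    refine Finset.sum_le_sum fun q _ => ?_
    have h5 : ∀ i ∈ Finset.univ.filter (fun i => c i = q), ((s i).card : ℝ)⁻¹
        = ((Finset.univ.filter (fun i => c i = q)).card : ℝ)⁻¹ := by
      intro i hi
      simp only [Finset.mem_filter, Finset.mem_univ, true_and] at hi
      simp [s, hi]
    rw [Finset.sum_congr rfl h5, Finset.sum_const, nsmul_eq_mul]
    exact mul_inv_le_one
  have hone : ∀ i, ∑ j, parSum a (r ^ 2 * l j) * inner ℝ (b j) (e i) ^ 2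
      ≤ a * ((s i).card : ℝ)⁻¹ + r ^ 2 * h := by
    intro i
    calc _ ≤ ∑ j, (a * inner ℝ (b j) (x i) ^ 2 + r ^ 2 * l j * inner ℝ (b j) (e i - x i) ^ 2) := by
          refine Finset.sum_le_sum fun j _ => ?_
          have := parSum_mul_sq_le ha (mul_nonneg (sq_nonneg r) (hl j)) (inner ℝ (b j) (x i))
            (inner ℝ (b j) (e i - x i))
          rwa [← inner_add_right, add_sub_cancel] at this
      _ = a * ‖x i‖ ^ 2 + r ^ 2 * ‖∑ j, (e i - x i) j • k j‖ ^ 2 := by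
          rw [hb, ← b.sum_sq_norm_inner_right (x i), Finset.sum_add_distrib, Finset.mul_sum,
            Finset.mul_sum]
          simp [mul_assoc]
      _ ≤ _ := by
          rw [hxn]
          gcongr
          exact hrest i
  have hbj : ∀ j, ∑ i, inner ℝ (b j) (e i) ^ 2 = 1 := by
    intro j
    have : ‖b j‖ ^ 2 = 1 := by simp
    rw [← this, EuclideanSpace.norm_sq_eq]
    simp [e, EuclideanSpace.inner_single_right]
  calc ∑ j, parSum a (r ^ 2 * l j)
      = ∑ j, ∑ i, parSum a (r ^ 2 * l j) * inner ℝ (b j) (e i) ^ 2 := by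
        refine Finset.sum_congr rfl fun j _ => ?_
        rw [← Finset.mul_sum, hbj, mul_one]
    _ = ∑ i, ∑ j, parSum a (r ^ 2 * l j) * inner ℝ (b j) (e i) ^ 2 := Finset.sum_comm
    _ ≤ ∑ i, (a * ((s i).card : ℝ)⁻¹ + r ^ 2 * h) := Finset.sum_le_sum fun i _ => hone i
    _ = a * ∑ i, ((s i).card : ℝ)⁻¹ + r ^ 2 * (n * h) := by
        rw [Finset.sum_add_distrib, ← Finset.mul_sum]
        simp
        ring
    _ ≤ _ := by gcongr

/-- Tail of the supremum of the Gaussian process `∑ ξ i ⟪g, k i⟫` over the localized ball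
`‖g‖ ≤ r`, `∑ ⟪g, k i⟫² ≤ a`, when the vectors `k i` are grouped into cells of squared diameter at
most `h`. -/
theorem measure_exists_le_sum_mul_inner_le {κ : Type*} [Fintype κ] {k : Fin n → H}
    {c : Fin n → κ} {h : ℝ} (hc : ∀ i j, c i = c j → ‖k i - k j‖ ^ 2 ≤ h)
    {a r u : ℝ} (ha : 0 < a) (hu : 0 ≤ u) :
    (Measure.pi fun _ : Fin n => gaussianReal 0 1)
        {ξ | ∃ g : H, ‖g‖ ≤ r ∧ ∑ i, inner ℝ g (k i) ^ 2 ≤ a ∧ u ≤ ∑ i, ξ i * inner ℝ g (k i)}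
      ≤ ENNReal.ofReal (Real.exp (-(u ^ 2 / (8 * a))
          + (a * Fintype.card κ + r ^ 2 * (n * h)) / (2 * a))) := by
  classical
  obtain ⟨b, l, hl, hb⟩ := exists_basis_norm_sum_smul_sq k
  have hl' : ∀ j, 0 ≤ r ^ 2 * l j := fun j => mul_nonneg (sq_nonneg r) (hl j)
  refine (measure_mono ?_).trans ((measure_pi_gaussian_quadratic_basis_le ha
    (fun j => parSum_nonneg ha (hl' j)) (fun j => parSum_le_left ha (hl' j)) (u ^ 2 / 2) b).trans
    (ENNReal.ofReal_le_ofReal (Real.exp_le_exp.2 (add_le_add (le_of_eq ?_) ?_))))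
  · rintro ξ ⟨g, hg, hga, hgu⟩
    have := sq_sum_mul_inner_le hl hb ha (WithLp.toLp 2 ξ) hg hga
    have h2 : u ^ 2 ≤ (∑ i, ξ i * inner ℝ g (k i)) ^ 2 := by gcongr
    simp only [mem_ofPred_eq]
    simp only at this
    linarith
  · ring
  · gcongr
    exact sum_parSum_le hc hl hb ha r

end Width

/-! ### Least squares over the image of a Hilbert ball -/

section Regression

variable {H : Type*} [NormedAddCommGroup H] [InnerProductSpace ℝ H] {n : ℕ}

/-- Cells of length `L / K`, with `K` of order `B / t`, balance the two terms of the trace bound.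
-/
theorem measure_exists_le_sum_mul_inner_le_exp {k : Fin n → H} {s : Fin n → ℝ} {L r B t σ : ℝ}
    (hn : 0 < n) (hL : 0 < L) (hs : ∀ i, s i ∈ Icc 0 L)
    (hk : ∀ i j, ‖k i - k j‖ ^ 2 ≤ |s i - s j|) (hB : r ^ 2 * L ≤ B ^ 2)
    (ht : 0 < t) (htB : t ≤ B) (hσ : 0 < σ) (htσ : 512 * B * σ ^ 2 ≤ n * t ^ 3) :
    (Measure.pi fun _ : Fin n => gaussianReal 0 1)
        {ξ | ∃ g : H, ‖g‖ ≤ r ∧ ∑ i, inner ℝ g (k i) ^ 2 ≤ n * t ^ 2 ∧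
          n * t ^ 2 / (4 * σ) ≤ ∑ i, ξ i * inner ℝ g (k i)}
      ≤ ENNReal.ofReal (Real.exp (-(n * t ^ 2 / (256 * σ ^ 2)))) := by
  have hn' : (0 : ℝ) < n := by exact_mod_cast hn
  have hBpos : 0 < B := ht.trans_le htB
  set K := ⌈B / t⌉₊
  have hK : B / t ≤ K := Nat.le_ceil _
  have hK1 : (K : ℝ) < B / t + 1 := Nat.ceil_lt_add_one (by positivity)
  have hBt : 1 ≤ B / t := (one_le_div ht).2 htB
  have hK0 : (0 : ℝ) < K := by linarith
  have hfl : ∀ i, 0 ≤ s i * (K / L) := fun i => mul_nonneg (hs i).1 (by positivity)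
  have hcell : ∀ i, ⌊s i * (K / L)⌋₊ < K + 1 := by
    intro i
    rw [Nat.lt_add_one_iff]
    refine Nat.floor_le_of_le ?_
    calc s i * (K / L) ≤ L * (K / L) := by gcongr; exact (hs i).2
      _ = K := by field_simp
  let c : Fin n → Fin (K + 1) := fun i => ⟨⌊s i * (K / L)⌋₊, hcell i⟩
  have hc : ∀ i j, c i = c j → ‖k i - k j‖ ^ 2 ≤ L / K := by
    intro i j hij
    have hij' : ⌊s i * (K / L)⌋₊ = ⌊s j * (K / L)⌋₊ := congrArg Fin.val hij
    refine (hk i j).trans ?_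
    have h1 := Nat.floor_le (hfl i)
    have h2 := Nat.floor_le (hfl j)
    have h3 := Nat.lt_floor_add_one (s i * (K / L))
    have h4 := Nat.lt_floor_add_one (s j * (K / L))
    rw [hij'] at h1 h3
    have h5 : |s i * (K / L) - s j * (K / L)| ≤ 1 := by rw [abs_le]; constructor <;> linarith
    rw [← sub_mul, abs_mul, abs_of_pos (by positivity : (K : ℝ) / L > 0)] at h5
    rw [le_div_iff₀ hK0]
    rw [mul_div_assoc', div_le_one hL] at h5
    exact h5
  refine (measure_exists_le_sum_mul_inner_le hc (a := n * t ^ 2) (r := r) (by positivity)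
    (by positivity)).trans (ENNReal.ofReal_le_ofReal (Real.exp_le_exp.2 ?_))
  have e1 : (n * t ^ 2 / (4 * σ)) ^ 2 / (8 * (n * t ^ 2)) = 2 * (n * t ^ 2 / (256 * σ ^ 2)) := by
    field_simp
    norm_num
  have e2 : (n * t ^ 2 * (Fintype.card (Fin (K + 1)) : ℝ) + r ^ 2 * (n * (L / K)))
      / (2 * (n * t ^ 2)) = (K + 1) / 2 + r ^ 2 * L / (2 * (K * t ^ 2)) := by
    simp only [Fintype.card_fin]
    push_cast
    field_simp
  have e3 : r ^ 2 * L / (2 * (K * t ^ 2)) ≤ B / t / 2 := by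
    rw [div_le_iff₀ (by positivity)]
    calc r ^ 2 * L ≤ B ^ 2 := hB
      _ = B / t / 2 * (2 * (B / t * t ^ 2)) := by field_simp
      _ ≤ _ := by gcongr
  have e4 : 2 * (B / t) ≤ n * t ^ 2 / (256 * σ ^ 2) := by
    rw [le_div_iff₀ (by positivity), mul_div_assoc', div_mul_eq_mul_div, div_le_iff₀ ht]
    nlinarith
  rw [e1, e2]
  linarith

/-- A direction of large empirical norm that satisfies the basic inequality of least squares is
shrunk to one of small empirical norm on which the noise is still large. All inequalities
become strict. -/
theorem exists_shrink {k : Fin n → H} {ξ : Fin n → ℝ} {r t σ : ℝ} (hn : 0 < n) (hr : 0 < r)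
    (ht : 0 < t) (hσ : 0 < σ) {g : H} (hg : ‖g‖ ≤ r) (hgt : n * t ^ 2 < ∑ i, inner ℝ g (k i) ^ 2)
    (hbasic : ∑ i, inner ℝ g (k i) ^ 2 ≤ 2 * σ * ∑ i, ξ i * inner ℝ g (k i)) :
    ∃ g' : H, ‖g'‖ < r ∧ ∑ i, inner ℝ g' (k i) ^ 2 < n * t ^ 2 ∧
      n * t ^ 2 / (4 * σ) < ∑ i, ξ i * inner ℝ g' (k i) := by
  have hn' : (0 : ℝ) < n := by exact_mod_cast hn
  set W := ∑ i, inner ℝ g (k i) ^ 2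
  set q := √(n * t ^ 2)
  have hq2 : q ^ 2 = n * t ^ 2 := Real.sq_sqrt (by positivity)
  have hq0 : 0 < q := Real.sqrt_pos.2 (by positivity)
  have hW0 : 0 < W := lt_trans (by positivity) hgt
  set p := √W
  have hp2 : p ^ 2 = W := Real.sq_sqrt hW0.le
  have hqp : q < p := Real.sqrt_lt_sqrt (by positivity) hgt
  have hp0 : 0 < p := hq0.trans hqp
  have hτ0 : 0 < q / p / 2 := by positivity
  have hτ1 : q / p < 1 := (div_lt_one hp0).2 hqp
  refine ⟨(q / p / 2) • g, ?_, ?_, ?_⟩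
  · rw [norm_smul, Real.norm_eq_abs, abs_of_pos hτ0]
    calc q / p / 2 * ‖g‖ ≤ 1 / 2 * r := by gcongr
      _ < r := by linarith
  · simp only [real_inner_smul_left, mul_pow, ← Finset.mul_sum]
    rw [← hq2]
    change _ * W < _
    rw [← hp2]
    have : (q / p / 2) ^ 2 * p ^ 2 = q ^ 2 / 4 := by field_simp; norm_num
    nlinarith
  · simp only [real_inner_smul_left]
    have h1 : ∑ i, ξ i * (q / p / 2 * inner ℝ g (k i))
        = q / p / 2 * ∑ i, ξ i * inner ℝ g (k i) := by
      rw [Finset.mul_sum]; exact Finset.sum_congr rfl fun i _ => by ring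
    have h2 : W / (2 * σ) ≤ ∑ i, ξ i * inner ℝ g (k i) := by
      rw [div_le_iff₀ (by positivity)]; linarith
    rw [h1]
    calc n * t ^ 2 / (4 * σ) = q * q / (4 * σ) := by rw [← hq2, sq]
      _ < q * p / (4 * σ) := by gcongr
      _ = q / p / 2 * (W / (2 * σ)) := by rw [← hp2]; field_simp; norm_num
      _ ≤ _ := by gcongr

variable {Ω : Type*} [MeasurableSpace Ω] {P : Measure Ω} [IsProbabilityMeasure P]

/-- Random design: an event on which some direction `g` has large empirical norm and satisfies the
basic inequality of least squares is exponentially unlikely. -/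
theorem measure_le_of_basic_inequality {k : ℝ → H} {s : ℝ → ℝ} {L r B t σ : ℝ}
    (hn : 0 < n) (hL : 0 < L) (hs : ∀ x, s x ∈ Icc 0 L) (hkc : Continuous k)
    (hk : ∀ x y, ‖k x - k y‖ ^ 2 ≤ |s x - s y|) (hkL : ∀ x, ‖k x‖ ^ 2 ≤ L)
    (hr : 0 < r) (hB0 : 0 < B) (hB : r ^ 2 * L ≤ B ^ 2)
    (ht : 0 < t) (hσ : 0 < σ) (htσ : 512 * B * σ ^ 2 ≤ n * t ^ 3)
    {X ξ : Fin n → Ω → ℝ} (hX : ∀ i, AEMeasurable (X i) P)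
    (hξ : ∀ i, HasLaw (ξ i) (gaussianReal 0 1) P) (hξi : iIndepFun ξ P)
    (hXξ : IndepFun (fun ω i => X i ω) (fun ω i => ξ i ω) P) {E : Set Ω}
    (hE : ∀ᵐ ω ∂P, ω ∈ E → ∃ g : H, ‖g‖ ≤ r ∧ n * t ^ 2 < ∑ i, inner ℝ g (k (X i ω)) ^ 2 ∧
      ∑ i, inner ℝ g (k (X i ω)) ^ 2 ≤ 2 * σ * ∑ i, ξ i ω * inner ℝ g (k (X i ω))) :
    P E ≤ ENNReal.ofReal (Real.exp (-(n * t ^ 2 / (256 * σ ^ 2)))) := by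
  have hn' : (0 : ℝ) < n := by exact_mod_cast hn
  rcases le_or_gt t B with htB | htB
  · -- the bad set of pairs (design, noise) is open, as a union of open sets over `g`
    set S : Set ((Fin n → ℝ) × (Fin n → ℝ)) := {z | ∃ g : H, ‖g‖ < r ∧
      ∑ i, inner ℝ g (k (z.1 i)) ^ 2 < n * t ^ 2 ∧
      n * t ^ 2 / (4 * σ) < ∑ i, z.2 i * inner ℝ g (k (z.1 i))}
    have hSo : IsOpen S := by
      have : S = ⋃ g : H, ⋃ _ : ‖g‖ < r, {z | ∑ i, inner ℝ g (k (z.1 i)) ^ 2 < n * t ^ 2} ∩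
          {z | n * t ^ 2 / (4 * σ) < ∑ i, z.2 i * inner ℝ g (k (z.1 i))} := by
        ext z
        simp [S, and_left_comm]
      rw [this]
      refine isOpen_iUnion fun g => isOpen_iUnion fun _ => ?_
      exact (isOpen_lt (by fun_prop) (by fun_prop)).inter (isOpen_lt (by fun_prop) (by fun_prop))
    have hξm : ∀ i, AEMeasurable (ξ i) P := fun i => (hξ i).aemeasurable
    have hXm : AEMeasurable (fun ω i => X i ω) P := aemeasurable_pi_iff.2 hX
    have hξm' : AEMeasurable (fun ω i => ξ i ω) P := aemeasurable_pi_iff.2 hξm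
    have hlaw : P.map (fun ω i => ξ i ω) = Measure.pi fun _ : Fin n => gaussianReal 0 1 := by
      rw [(iIndepFun_iff_map_fun_eq_pi_map hξm).1 hξi]
      congr 1
      funext i
      exact (hξ i).map_eq
    have hprob : IsProbabilityMeasure (P.map fun ω i => X i ω) :=
      Measure.isProbabilityMeasure_map hXm
    calc P E ≤ P {ω | ((fun i => X i ω), (fun i => ξ i ω)) ∈ S} := by
          refine measure_mono_ae ?_
          filter_upwards [hE] with ω hω hωE
          obtain ⟨g, hg, h1, h2⟩ := hω hωE
          exact exists_shrink (k := fun i => k (X i ω)) (ξ := fun i => ξ i ω) hn hr ht hσ hg h1 h2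
      _ = (P.map fun ω => ((fun i => X i ω), (fun i => ξ i ω))) S :=
          (Measure.map_apply_of_aemeasurable (hXm.prodMk hξm') hSo.measurableSet).symm
      _ = ((P.map fun ω i => X i ω).prod (Measure.pi fun _ : Fin n => gaussianReal 0 1)) S := by
          rw [(indepFun_iff_map_prod_eq_prod_map_map hXm hξm').1 hXξ, hlaw]
      _ = ∫⁻ x, (Measure.pi fun _ : Fin n => gaussianReal 0 1) (Prod.mk x ⁻¹' S)
            ∂(P.map fun ω i => X i ω) := Measure.prod_apply hSo.measurableSet
      _ ≤ ∫⁻ _, ENNReal.ofReal (Real.exp (-(n * t ^ 2 / (256 * σ ^ 2))))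
            ∂(P.map fun ω i => X i ω) := by
          refine lintegral_mono fun x => ?_
          refine (measure_mono ?_).trans (measure_exists_le_sum_mul_inner_le_exp
            (k := fun i => k (x i)) (s := fun i => s (x i)) hn hL (fun i => hs _)
            (fun i j => hk _ _) hB ht htB hσ htσ)
          rintro ξ ⟨g, hg, h1, h2⟩
          exact ⟨g, hg.le, h1.le, h2.le⟩
      _ = _ := by simp
  · -- all values are at most `B < t` in absolute value, so the event is null
    have : P E = 0 := by
      rw [← nonpos_iff_eq_zero]
      refine (measure_mono_ae ?_).trans (measure_empty (μ := P)).le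
      filter_upwards [hE] with ω hω hωE
      obtain ⟨g, hg, h1, -⟩ := hω hωE
      have h3 : ∑ i, inner ℝ g (k (X i ω)) ^ 2 ≤ ∑ _i : Fin n, B ^ 2 := by
        refine Finset.sum_le_sum fun i _ => ?_
        calc inner ℝ g (k (X i ω)) ^ 2 = |inner ℝ g (k (X i ω))| ^ 2 := (sq_abs _).symm
          _ ≤ (‖g‖ * ‖k (X i ω)‖) ^ 2 := by gcongr; exact abs_real_inner_le_norm _ _
          _ = ‖g‖ ^ 2 * ‖k (X i ω)‖ ^ 2 := mul_pow _ _ _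
          _ ≤ r ^ 2 * L := by gcongr; exact hkL _
          _ ≤ B ^ 2 := hB
      simp only [Finset.sum_const, Finset.card_univ, Fintype.card_fin, nsmul_eq_mul] at h3
      have h4 : B ^ 2 < t ^ 2 := by gcongr
      have h5 : (n : ℝ) * B ^ 2 < n * t ^ 2 := by gcongr
      linarith
    rw [this]
    exact zero_le

/-- The basic inequality of least squares. -/
theorem IsLeastSquares.basic_inequality {C : Set (ℝ → ℝ)} {ε σ : ℝ} (hn : 0 < n)
    {x ξ : Fin n → ℝ} {f : ℝ → ℝ} (hC : ramp ε ∈ C)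
    (hf : IsLeastSquares C x (response ε σ x ξ) f) :
    ∑ i, (f (x i) - ramp ε (x i)) ^ 2 ≤ 2 * σ * ∑ i, ξ i * (f (x i) - ramp ε (x i)) := by
  have hn' : (0 : ℝ) < 1 / n := by positivity
  have h1 := le_of_mul_le_mul_left (hf.2 hC) hn'
  rw [← sub_nonneg, ← Finset.sum_sub_distrib] at h1
  rw [← sub_nonneg, Finset.mul_sum, ← Finset.sum_sub_distrib]
  refine h1.trans (le_of_eq (Finset.sum_congr rfl fun i _ => ?_))
  simp only [response]
  ring

/-- Risk bound for least squares over a class of functions `x ↦ ⟪g, k x⟫` with `‖g‖ ≤ R`. -/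
theorem measure_isLeastSquares_le {k : ℝ → H} {s : ℝ → ℝ} {L R B t σ ε : ℝ}
    (hn : 0 < n) (hL : 0 < L) (hs : ∀ x, s x ∈ Icc 0 L) (hkc : Continuous k)
    (hk : ∀ x y, ‖k x - k y‖ ^ 2 ≤ |s x - s y|) (hkL : ∀ x, ‖k x‖ ^ 2 ≤ L)
    (hR : 0 < R) (hB0 : 0 < B) (hB : (2 * R) ^ 2 * L ≤ B ^ 2)
    (ht : 0 < t) (hσ : 0 < σ) (htσ : 512 * B * σ ^ 2 ≤ n * t ^ 3) {C : Set (ℝ → ℝ)}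
    (hC : ∀ f ∈ C, ∃ g : H, ‖g‖ ≤ R ∧ ∀ x ∈ Icc (-1 : ℝ) 1, f x = inner ℝ g (k x))
    (hramp : ramp ε ∈ C) {X ξ : Fin n → Ω → ℝ} (hS : IsSample P ε X ξ)
    (hX : ∀ᵐ ω ∂P, ∀ i, X i ω ∈ Icc (-1 : ℝ) 1) :
    P {ω | ∃ f : ℝ → ℝ, IsLeastSquares C (fun i => X i ω)
          (response ε σ (fun i => X i ω) (fun i => ξ i ω)) f ∧
        t ^ 2 < empNormSq (fun i => X i ω) (fun x => f x - ramp ε x)}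
      ≤ ENNReal.ofReal (Real.exp (-(n * t ^ 2 / (256 * σ ^ 2)))) := by
  have hn' : (0 : ℝ) < n := by exact_mod_cast hn
  refine measure_le_of_basic_inequality (r := 2 * R) hn hL hs hkc hk hkL (by positivity) hB0 hB ht
    hσ htσ (fun i => (hS.law_design i).aemeasurable) hS.law_noise hS.indep_noise hS.indep ?_
  filter_upwards [hX] with ω hω
  rintro ⟨f, hf, hft⟩
  obtain ⟨g, hg, hgf⟩ := hC f hf.1
  obtain ⟨g₀, hg₀, hgf₀⟩ := hC _ hramp
  have hd : ∀ i, inner ℝ (g - g₀) (k (X i ω)) = f (X i ω) - ramp ε (X i ω) := fun i => by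
    rw [inner_sub_left, hgf _ (hω i), hgf₀ _ (hω i)]
  refine ⟨g - g₀, (norm_sub_le _ _).trans (by linarith), ?_, ?_⟩
  · simp only [hd]
    rw [empNormSq, one_div, inv_mul_eq_div, lt_div_iff₀ hn'] at hft
    linarith
  · simp only [hd]
    exact hf.basic_inequality hn hramp

end Regression

/-! ### The weighted Sobolev ball as the image of a Hilbert ball -/

/-- Lebesgue measure on `[-1, 1]`. -/
noncomputable abbrev volIcc : Measure ℝ := volume.restrict (Icc (-1 : ℝ) 1)

theorem memLp_inv_of_le {p : ℝ → ℝ} (hpm : Measurable p) {p₀ : ℝ} (h0 : 0 < p₀)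
    (hp : ∀ x ∈ Icc (-1 : ℝ) 1, p₀ ≤ p x) : MemLp (fun t => (p t)⁻¹) 2 volIcc := by
  refine MemLp.of_bound hpm.inv.aestronglyMeasurable p₀⁻¹ ?_
  filter_upwards [ae_restrict_mem measurableSet_Icc] with t ht
  have h1 := hp t ht
  rw [Real.norm_of_nonneg (inv_nonneg.2 (h0.le.trans h1))]
  exact inv_anti₀ h0 h1

/-- The odd absolutely continuous functions with weighted energy `∫ f'² p²` at most `R²`. -/
def energyBall (p : ℝ → ℝ) (R : ℝ) : Set (ℝ → ℝ) :=
  {f | IsOddAC f ∧ IntegrableOn (fun x => deriv f x ^ 2 * p x ^ 2) (Icc (-1) 1) ∧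
    ∫ x in Icc (-1 : ℝ) 1, deriv f x ^ 2 * p x ^ 2 ≤ R ^ 2}

/-- The element `1_{t ≤ x} / p` of `L²[-1, 1]`. -/
noncomputable def cutVec {p : ℝ → ℝ} (hp : MemLp (fun t => (p t)⁻¹) 2 volIcc) (x : ℝ) :
    Lp ℝ 2 volIcc :=
  MemLp.toLp ((Iic x).indicator fun t => (p t)⁻¹) (hp.indicator measurableSet_Iic)

/-- The element `(1_{t ≤ x} - 1_{t ≤ 0}) / p` of `L²[-1, 1]`. For `f` with `f 0 = 0` its inner
product with `f' p` is `f x`. -/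
noncomputable def evalVec {p : ℝ → ℝ} (hp : MemLp (fun t => (p t)⁻¹) 2 volIcc) (x : ℝ) :
    Lp ℝ 2 volIcc :=
  cutVec hp x - cutVec hp 0

/-- The increasing function whose increments are the squared distances between evaluation
vectors. -/
noncomputable def evalScale (p : ℝ → ℝ) (x : ℝ) : ℝ := ∫ t in Iic x, (p t)⁻¹ ^ 2 ∂volIcc

section Representation

variable {p : ℝ → ℝ}

theorem evalScale_mem_Icc (hp : MemLp (fun t => (p t)⁻¹) 2 volIcc) {L : ℝ}
    (hL : ∫ t, (p t)⁻¹ ^ 2 ∂volIcc ≤ L) (x : ℝ) :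
    evalScale p x ∈ Icc 0 L :=
  ⟨integral_nonneg fun _ => sq_nonneg _,
    (setIntegral_le_integral hp.integrable_sq
      (Filter.Eventually.of_forall fun _ => sq_nonneg _)).trans hL⟩

theorem continuous_evalScale (hp : MemLp (fun t => (p t)⁻¹) 2 volIcc)
    : Continuous (evalScale p) := by
  have h : evalScale p = fun x => evalScale p 0 + ∫ t in (0 : ℝ)..x, (p t)⁻¹ ^ 2 ∂volIcc := by
    funext x
    rw [← intervalIntegral.integral_Iic_sub_Iic hp.integrable_sq.integrableOn
      hp.integrable_sq.integrableOn]
    simp [evalScale]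
  rw [h]
  exact continuous_const.add (intervalIntegral.continuous_primitive
    (fun a b => hp.integrable_sq.intervalIntegrable) 0)

theorem coeFn_cutVec (hp : MemLp (fun t => (p t)⁻¹) 2 volIcc) (x : ℝ) :
    cutVec hp x =ᵐ[volIcc] (Iic x).indicator fun t => (p t)⁻¹ :=
  MemLp.coeFn_toLp _

theorem norm_evalVec_sub_sq_of_le (hp : MemLp (fun t => (p t)⁻¹) 2 volIcc) {x y : ℝ}
    (hxy : y ≤ x) : ‖evalVec hp x - evalVec hp y‖ ^ 2 = evalScale p x - evalScale p y := by
  have h1 : evalVec hp x - evalVec hp y = cutVec hp x - cutVec hp y := by simp [evalVec]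
  have hi : ∀ z : ℝ, Integrable ((Iic z).indicator fun t => (p t)⁻¹ ^ 2) volIcc := fun z =>
    hp.integrable_sq.indicator measurableSet_Iic
  have h2 : ∀ z : ℝ, evalScale p z = ∫ t, (Iic z).indicator (fun t => (p t)⁻¹ ^ 2) t ∂volIcc :=
    fun z => (integral_indicator measurableSet_Iic).symm
  rw [h1, ← real_inner_self_eq_norm_sq, L2.inner_def, h2, h2, ← integral_sub (hi x) (hi y)]
  refine integral_congr_ae ?_
  filter_upwards [Lp.coeFn_sub (cutVec hp x) (cutVec hp y), coeFn_cutVec hp x, coeFn_cutVec hp y]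
    with t ht hx hy
  rw [ht, Pi.sub_apply, hx, hy, RCLike.inner_apply, conj_trivial]
  by_cases h2 : t ≤ y
  · simp [h2, h2.trans hxy]
  · by_cases h3 : t ≤ x <;> simp [h2, h3, sq]

theorem norm_evalVec_sub_sq (hp : MemLp (fun t => (p t)⁻¹) 2 volIcc)
    (x y : ℝ) :
    ‖evalVec hp x - evalVec hp y‖ ^ 2 = |evalScale p x - evalScale p y| := by
  rcases le_total y x with h | h
  · rw [norm_evalVec_sub_sq_of_le hp h, abs_of_nonneg]
    rw [← norm_evalVec_sub_sq_of_le hp h]; positivity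
  · rw [norm_sub_rev, norm_evalVec_sub_sq_of_le hp h, abs_sub_comm, abs_of_nonneg]
    rw [← norm_evalVec_sub_sq_of_le hp h]; positivity

theorem continuous_evalVec (hp : MemLp (fun t => (p t)⁻¹) 2 volIcc)
    : Continuous (evalVec hp) := by
  rw [continuous_iff_continuousAt]
  intro x
  rw [ContinuousAt, tendsto_iff_norm_sub_tendsto_zero]
  have h : (fun y => ‖evalVec hp y - evalVec hp x‖)
      = fun y => √|evalScale p y - evalScale p x| := by
    funext y
    rw [← norm_evalVec_sub_sq, Real.sqrt_sq (norm_nonneg _)]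
  rw [h]
  have hc := continuous_evalScale hp
  have h2 : Continuous fun y => √|evalScale p y - evalScale p x| := by fun_prop
  simpa using h2.tendsto x

theorem norm_evalVec_sq_le (hp : MemLp (fun t => (p t)⁻¹) 2 volIcc)
    {L : ℝ} (hL : ∫ t, (p t)⁻¹ ^ 2 ∂volIcc ≤ L) (x : ℝ) :
    ‖evalVec hp x‖ ^ 2 ≤ L := by
  have h0 : evalVec hp 0 = 0 := by simp [evalVec]
  have h1 := norm_evalVec_sub_sq hp x 0
  rw [h0, sub_zero] at h1
  rw [h1, abs_le]
  have h2 := evalScale_mem_Icc hp hL x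
  have h3 := evalScale_mem_Icc hp hL 0
  constructor <;> linarith [h2.1, h2.2, h3.1, h3.2]

theorem integrable_mul_inv (hp : MemLp (fun t => (p t)⁻¹) 2 volIcc)
    (g : Lp ℝ 2 volIcc) : Integrable (fun t => g t * (p t)⁻¹) volIcc :=
  (Lp.memLp g).integrable_mul hp

theorem inner_evalVec (hp : MemLp (fun t => (p t)⁻¹) 2 volIcc)
    (g : Lp ℝ 2 volIcc) {x : ℝ} (hx : x ∈ Icc (-1 : ℝ) 1) :
    inner ℝ g (evalVec hp x) = ∫ t in (0 : ℝ)..x, g t * (p t)⁻¹ := by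
  have h1 : ∀ y : ℝ, inner ℝ g (cutVec hp y) = ∫ t in Iic y, g t * (p t)⁻¹ ∂volIcc := by
    intro y
    rw [L2.inner_def, ← integral_indicator measurableSet_Iic]
    refine integral_congr_ae ?_
    filter_upwards [coeFn_cutVec hp y] with t ht
    rw [ht, RCLike.inner_apply, conj_trivial]
    by_cases h2 : t ≤ y <;> simp [h2, mul_comm]
  have hi := integrable_mul_inv hp g
  rw [evalVec, inner_sub_right, h1, h1,
    intervalIntegral.integral_Iic_sub_Iic hi.integrableOn hi.integrableOn]
  have h0 : (0 : ℝ) ∈ Icc (-1 : ℝ) 1 := by constructor <;> norm_num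
  have hsub : uIoc (0 : ℝ) x ⊆ Icc (-1 : ℝ) 1 :=
    uIoc_subset_uIcc.trans (uIcc_subset_Icc h0 hx)
  rw [intervalIntegral.intervalIntegral_eq_integral_uIoc,
    intervalIntegral.intervalIntegral_eq_integral_uIoc, Measure.restrict_restrict_of_subset hsub]

/-- Every function of the energy ball is `x ↦ ⟪f' p, evalVec x⟫`. -/
theorem exists_inner_evalVec_of_mem_energyBall (hp : MemLp (fun t => (p t)⁻¹) 2 volIcc)
    (hpm : Measurable p)
    (hp0 : ∀ x ∈ Icc (-1 : ℝ) 1, p x ≠ 0) {R : ℝ} (hR : 0 ≤ R) {f : ℝ → ℝ}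
    (hf : f ∈ energyBall p R) :
    ∃ g : Lp ℝ 2 volIcc, ‖g‖ ≤ R ∧ ∀ x ∈ Icc (-1 : ℝ) 1, f x = inner ℝ g (evalVec hp x) := by
  obtain ⟨⟨hac, hodd⟩, hint, hle⟩ := hf
  have hm : MemLp (fun t => deriv f t * p t) 2 volIcc := by
    refine (memLp_two_iff_integrable_sq
      ((measurable_deriv f).mul hpm).aestronglyMeasurable).2 ?_
    simp_rw [Pi.mul_apply, mul_pow]
    exact hint
  have h0 : (0 : ℝ) ∈ Icc (-1 : ℝ) 1 := by constructor <;> norm_num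
  refine ⟨hm.toLp _, ?_, fun x hx => ?_⟩
  · refine le_of_sq_le_sq ?_ hR
    rw [← real_inner_self_eq_norm_sq, L2.inner_def]
    refine le_trans (le_of_eq (integral_congr_ae ?_)) hle
    filter_upwards [hm.coeFn_toLp] with t ht
    rw [ht]
    simp only [RCLike.inner_apply, conj_trivial]
    ring
  · have hsub : uIcc 0 x ⊆ Icc (-1 : ℝ) 1 := uIcc_subset_Icc h0 hx
    have hf0 : f 0 = 0 := by
      have := hodd 0 h0
      rw [neg_zero] at this
      linarith
    have hac' : AbsolutelyContinuousOnInterval f 0 x :=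
      hac.mono (by rwa [uIcc_of_le (by norm_num : (-1 : ℝ) ≤ 1)])
    have h1 := hac'.integral_deriv_eq_sub
    rw [hf0, sub_zero] at h1
    rw [inner_evalVec hp _ hx, ← h1]
    refine intervalIntegral.integral_congr_ae ?_
    have h2 := (ae_restrict_iff' measurableSet_Icc).1 hm.coeFn_toLp
    filter_upwards [h2] with t ht htx
    have ht1 : t ∈ Icc (-1 : ℝ) 1 := hsub (uIoc_subset_uIcc htx)
    rw [ht ht1, mul_assoc, mul_inv_cancel₀ (hp0 t ht1), mul_one]

end Representation

theorem measurePreserving_neg_volIcc : MeasurePreserving (fun x : ℝ => -x) volIcc volIcc := by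
  have h := (Measure.measurePreserving_neg (volume : Measure ℝ)).restrict_preimage
    (measurableSet_Icc (a := (-1 : ℝ)) (b := 1))
  have h2 : (Neg.neg ⁻¹' Icc (-1 : ℝ) 1) = Icc (-1 : ℝ) 1 := by
    ext x
    simp only [mem_preimage, mem_Icc]
    constructor <;> rintro ⟨h1, h2⟩ <;> constructor <;> linarith
  rw [h2] at h
  exact h

/-- Conversely every `x ↦ ⟪g, (evalVec x - evalVec (-x)) / 2⟫` with `‖g‖ ≤ R` is in the energy
ball: it is the primitive of the even part of `g / p`. -/
theorem exists_mem_energyBall {p : ℝ → ℝ} (hp : MemLp (fun t => (p t)⁻¹) 2 volIcc)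
    (hpm : Measurable p) (hpe : ∀ x, p (-x) = p x) {R : ℝ} {g : Lp ℝ 2 volIcc} (hg : ‖g‖ ≤ R)
    (hp0 : ∀ x ∈ Icc (-1 : ℝ) 1, p x ≠ 0) :
    ∃ f ∈ energyBall p R, ∀ x ∈ Icc (-1 : ℝ) 1,
      f x = inner ℝ g ((1 / 2 : ℝ) • (evalVec hp x - evalVec hp (-x))) := by
  set q : ℝ → ℝ := fun t => g t * (p t)⁻¹
  have hq : Integrable q volIcc := integrable_mul_inv hp g
  have hqn : Integrable (fun t => q (-t)) volIcc :=
    measurePreserving_neg_volIcc.integrable_comp_of_integrable hq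
  set e : ℝ → ℝ := fun t => (1 / 2 : ℝ) * (q t + q (-t))
  have he : Integrable e volIcc := (hq.add hqn).const_mul _
  have hII : ∀ {h : ℝ → ℝ}, Integrable h volIcc → IntervalIntegrable h volume (-1) 1 := by
    intro h hh
    rw [intervalIntegrable_iff_integrableOn_Icc_of_le (by norm_num)]
    exact hh
  have h11 : uIcc (-1 : ℝ) 1 = Icc (-1) 1 := uIcc_of_le (by norm_num)
  have h0 : (0 : ℝ) ∈ Icc (-1 : ℝ) 1 := by constructor <;> norm_num
  have hsub : ∀ {x : ℝ}, x ∈ Icc (-1 : ℝ) 1 → uIcc 0 x ⊆ uIcc (-1 : ℝ) 1 := fun hx => by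
    rw [h11]; exact uIcc_subset_Icc h0 hx
  set f : ℝ → ℝ := fun x => ∫ t in (0 : ℝ)..x, e t
  have hder : ∀ᵐ x ∂volIcc, deriv f x = e x := by
    rw [ae_restrict_iff' measurableSet_Icc]
    filter_upwards [(hII he).ae_hasDerivAt_integral] with x hx hx1
    rw [h11] at hx
    exact (hx hx1 0 h0).deriv
  have hg2 : Integrable (fun t => g t ^ 2) volIcc := (Lp.memLp g).integrable_sq
  have hg2n : Integrable (fun t => g (-t) ^ 2) volIcc :=
    measurePreserving_neg_volIcc.integrable_comp_of_integrable hg2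
  have hbound : ∀ᵐ x ∂volIcc, deriv f x ^ 2 * p x ^ 2 ≤ 1 / 2 * (g x ^ 2 + g (-x) ^ 2) := by
    filter_upwards [hder, ae_restrict_mem measurableSet_Icc] with x hx hx1
    have hpx := hp0 x hx1
    have : deriv f x * p x = 1 / 2 * (g x + g (-x)) := by
      rw [hx]
      simp only [e, q, hpe]
      field_simp
    rw [← mul_pow, this]
    nlinarith [sq_nonneg (g x - g (-x))]
  have hdom : Integrable (fun x => 1 / 2 * (g x ^ 2 + g (-x) ^ 2)) volIcc :=
    (hg2.add hg2n).const_mul _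
  have hint : Integrable (fun x => deriv f x ^ 2 * p x ^ 2) volIcc := by
    refine hdom.mono' (((measurable_deriv f).pow_const 2).mul
      (hpm.pow_const 2)).aestronglyMeasurable ?_
    filter_upwards [hbound] with x hx
    rwa [Real.norm_of_nonneg (by positivity)]
  have hgn : ∫ t, g (-t) ^ 2 ∂volIcc = ∫ t, g t ^ 2 ∂volIcc :=
    measurePreserving_neg_volIcc.integral_comp (Homeomorph.neg ℝ).measurableEmbedding
      (fun t => g t ^ 2)
  have hnorm : ∫ t, g t ^ 2 ∂volIcc = ‖g‖ ^ 2 := by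
    rw [← real_inner_self_eq_norm_sq, L2.inner_def]
    refine integral_congr_ae (Filter.Eventually.of_forall fun t => ?_)
    simp [sq]
  refine ⟨f, ⟨⟨?_, fun x _ => ?_⟩, hint, ?_⟩, fun x hx => ?_⟩
  · exact (hII he).absolutelyContinuousOnInterval_intervalIntegral (by rwa [h11])
  · have h1 : ∫ t in (0 : ℝ)..x, e (-t) = ∫ t in (-x)..(-0), e t :=
      intervalIntegral.integral_comp_neg e
    have h2 : ∀ t, e (-t) = e t := fun t => by simp only [e, neg_neg]; ring
    simp only [h2, neg_zero] at h1
    simp only [f]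
    rw [h1, intervalIntegral.integral_symm]
  · calc _ ≤ ∫ x, 1 / 2 * (g x ^ 2 + g (-x) ^ 2) ∂volIcc := integral_mono_ae hint hdom hbound
      _ = ‖g‖ ^ 2 := by
          rw [integral_const_mul, integral_add hg2 hg2n, hgn, hnorm]; ring
      _ ≤ R ^ 2 := by gcongr
  · have hnx : -x ∈ Icc (-1 : ℝ) 1 := ⟨by linarith [hx.2], by linarith [hx.1]⟩
    rw [inner_smul_right, inner_sub_right, inner_evalVec hp g hx, inner_evalVec hp g hnx]
    have h1 : ∫ t in (0 : ℝ)..x, q (-t) = ∫ t in (-x)..(-0), q t :=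
      intervalIntegral.integral_comp_neg q
    rw [neg_zero, intervalIntegral.integral_symm (a := 0) (b := -x)] at h1
    simp only [f, e]
    rw [intervalIntegral.integral_const_mul, intervalIntegral.integral_add
      ((hII hq).mono_set (hsub hx)) ((hII hqn).mono_set (hsub hx)), h1]
    simp only [q]
    ring

/-! ### Existence of least squares solutions -/

/-- A continuous linear map to a finite-dimensional space, given by finitely many inner products,
maps closed balls to compact sets: project the ball to the span of the representing vectors. -/
theorem isCompact_image_inner_closedBall {H : Type*} [NormedAddCommGroup H]
    [InnerProductSpace ℝ H] {n : ℕ} (k : Fin n → H) (R : ℝ) :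
    IsCompact ((fun (g : H) (i : Fin n) => inner ℝ g (k i)) '' Metric.closedBall 0 R) := by
  let S := Submodule.span ℝ (range k)
  have hfd : FiniteDimensional ℝ S := FiniteDimensional.span_of_finite ℝ (finite_range k)
  have hps : ProperSpace S := FiniteDimensional.proper ℝ S
  have h : (fun (g : H) (i : Fin n) => inner ℝ g (k i)) '' Metric.closedBall 0 R
      = (fun (g : S) (i : Fin n) => inner ℝ (g : H) (k i)) '' Metric.closedBall 0 R := by
    ext v
    constructor
    · rintro ⟨g, hg, rfl⟩
      refine ⟨S.orthogonalProjectionOnto g, ?_, ?_⟩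
      · rw [mem_closedBall_zero_iff] at hg ⊢
        exact (Submodule.norm_orthogonalProjectionOnto_apply_le S g).trans hg
      · funext i
        have hk : k i ∈ S := Submodule.subset_span (mem_range_self i)
        exact Submodule.inner_orthogonalProjectionOnto_eq_of_mem_right (K := S) ⟨k i, hk⟩ g
    · rintro ⟨g, hg, rfl⟩
      exact ⟨g, by simpa using hg, rfl⟩
  rw [h]
  exact (isCompact_closedBall _ _).image (by fun_prop)

theorem exists_isLeastSquares_of_isCompact {n : ℕ} {C : Set (ℝ → ℝ)} {x : Fin n → ℝ}
    (hC : IsCompact ((fun (f : ℝ → ℝ) (i : Fin n) => f (x i)) '' C)) (hne : C.Nonempty)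
    (y : Fin n → ℝ) : ∃ f, IsLeastSquares C x y f := by
  have hcont : Continuous fun v : Fin n → ℝ => (1 / (n : ℝ)) * ∑ i, (y i - v i) ^ 2 := by fun_prop
  obtain ⟨_, ⟨f, hf, rfl⟩, hmin⟩ := hC.exists_isMinOn (hne.image _) hcont.continuousOn
  exact ⟨f, hf, fun f' hf' => hmin (mem_image_of_mem _ hf')⟩

theorem isCompact_values_energyBall {p : ℝ → ℝ} (hp : MemLp (fun t => (p t)⁻¹) 2 volIcc)
    (hpm : Measurable p) (hpe : ∀ x, p (-x) = p x) (hp0 : ∀ x ∈ Icc (-1 : ℝ) 1, p x ≠ 0)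
    {R : ℝ} (hR : 0 ≤ R) {n : ℕ} {x : Fin n → ℝ} (hx : ∀ i, x i ∈ Icc (-1 : ℝ) 1) :
    IsCompact ((fun (f : ℝ → ℝ) (i : Fin n) => f (x i)) '' energyBall p R) := by
  convert isCompact_image_inner_closedBall
    (fun i => (1 / 2 : ℝ) • (evalVec hp (x i) - evalVec hp (-(x i)))) R using 1
  ext v
  constructor
  · rintro ⟨f, hf, rfl⟩
    obtain ⟨g, hg, hgf⟩ := exists_inner_evalVec_of_mem_energyBall hp hpm hp0 hR hf
    refine ⟨g, by simpa using hg, ?_⟩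
    funext i
    have hnx : -(x i) ∈ Icc (-1 : ℝ) 1 := ⟨by linarith [(hx i).2], by linarith [(hx i).1]⟩
    simp only
    rw [inner_smul_right, inner_sub_right, ← hgf _ (hx i), ← hgf _ hnx, hf.1.2 _ (hx i)]
    ring
  · rintro ⟨g, hg, rfl⟩
    obtain ⟨f, hf, hfg⟩ := exists_mem_energyBall hp hpm hpe (by simpa using hg) hp0
    exact ⟨f, hf, funext fun i => hfg _ (hx i)⟩

/-! ### The density and the ramp -/

section Density

variable {ε : ℝ}

theorem densB_pos (h0 : 0 < ε) : 0 < densB ε := Real.sqrt_pos.2 h0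

theorem densB_sq (h0 : 0 < ε) : densB ε ^ 2 = ε := Real.sq_sqrt h0.le

theorem one_fourth_le_densA (h0 : 0 < ε) (h1 : ε < 1 / 2) : 1 / 4 ≤ densA ε := by
  have hb : densB ε ≤ 3 / 4 := by
    rw [densB, Real.sqrt_le_left (by norm_num)]
    linarith
  rw [densA, le_div_iff₀ (by linarith)]
  nlinarith

theorem dens_neg (x : ℝ) : dens ε (-x) = dens ε x := by simp [dens]

theorem measurable_dens : Measurable (dens ε) := by
  unfold dens
  exact Measurable.ite (measurableSet_le (by fun_prop) (by fun_prop)) (by fun_prop)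
    (Measurable.ite (measurableSet_le (by fun_prop) (by fun_prop)) (by fun_prop) (by fun_prop))

theorem min_le_dens (h0 : 0 < ε) (h1 : ε < 1 / 2) {x : ℝ} (hx : x ∈ Icc (-1 : ℝ) 1) :
    min (densB ε) (1 / 4) ≤ dens ε x := by
  have hx' : |x| ≤ 1 := abs_le.2 hx
  unfold dens
  split_ifs
  · exact min_le_left _ _
  · exact (min_le_right _ _).trans (one_fourth_le_densA h0 h1)

theorem min_densB_pos (h0 : 0 < ε) : 0 < min (densB ε) (1 / 4) :=
  lt_min (densB_pos h0) (by norm_num)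

theorem memLp_inv_dens (h0 : 0 < ε) (h1 : ε < 1 / 2) :
    MemLp (fun t => (dens ε t)⁻¹) 2 volIcc :=
  memLp_inv_of_le measurable_dens (min_densB_pos h0) fun _ hx => min_le_dens h0 h1 hx

theorem integral_indicator_const_volIcc (h0 : 0 < ε) (h1 : ε < 1 / 2) (c : ℝ) :
    ∫ t, (Icc (-ε) ε).indicator (fun _ => c) t ∂volIcc = 2 * ε * c := by
  rw [integral_indicator measurableSet_Icc, Measure.restrict_restrict_of_subset
    (Icc_subset_Icc (by linarith) (by linarith)), setIntegral_const, Real.volume_real_Icc_of_le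
    (by linarith), smul_eq_mul]
  ring

/-- The total length of the reparametrized interval is bounded uniformly in `ε`. -/
theorem integral_inv_dens_sq_le (h0 : 0 < ε) (h1 : ε < 1 / 2) :
    ∫ t, (dens ε t)⁻¹ ^ 2 ∂volIcc ≤ 34 := by
  have hi : Integrable ((Icc (-ε) ε).indicator fun _ => ε⁻¹) volIcc :=
    (integrable_const _).indicator measurableSet_Icc
  calc ∫ t, (dens ε t)⁻¹ ^ 2 ∂volIcc
      ≤ ∫ t, ((Icc (-ε) ε).indicator (fun _ => ε⁻¹) t + 16) ∂volIcc := by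
        refine integral_mono_ae (memLp_inv_dens h0 h1).integrable_sq
          (hi.add (integrable_const _)) ?_
        filter_upwards [ae_restrict_mem measurableSet_Icc] with t ht
        have ht' : |t| ≤ 1 := abs_le.2 ht
        by_cases h : |t| ≤ ε
        · rw [indicator_of_mem (mem_Icc.2 (abs_le.1 h)), dens, if_pos h, inv_pow, densB_sq h0]
          linarith
        · rw [indicator_of_notMem (fun h2 => h (abs_le.2 (mem_Icc.1 h2))), dens, if_neg h,
            if_pos ht', inv_pow, zero_add]
          have := one_fourth_le_densA h0 h1
          rw [inv_le_comm₀ (by positivity) (by norm_num)]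
          nlinarith
    _ = 34 := by
        rw [integral_add hi (integrable_const _), integral_indicator_const_volIcc h0 h1]
        simp [h0.ne']
        field_simp
        norm_num

theorem sobolevBall_eq_energyBall : sobolevBall ε = energyBall (dens ε) 2 := by
  ext f
  simp only [sobolevBall, sobolevSpace, energyBall, sobolevNorm, mem_ofPred_eq, and_assoc]
  rw [Real.sqrt_le_left (by norm_num)]

theorem ramp_eq (h0 : 0 < ε) (x : ℝ) : ramp ε x = max (-1) (min 1 (x / ε)) := by
  unfold ramp
  split_ifs with h1 h2
  · have : x / ε < -1 := by rw [div_lt_iff₀ h0]; linarith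
    rw [min_eq_right (by linarith), max_eq_left (by linarith)]
  · have h3 : x / ε ≤ 1 := by rw [div_le_iff₀ h0]; linarith
    have h4 : -1 ≤ x / ε := by rw [le_div_iff₀ h0]; linarith
    rw [min_eq_right h3, max_eq_right h4]
  · have h3 : 1 ≤ x / ε := by rw [le_div_iff₀ h0]; linarith
    rw [min_eq_left h3, max_eq_right (by norm_num)]

theorem lipschitzWith_ramp (h0 : 0 < ε) : LipschitzWith (Real.toNNReal (1 / ε)) (ramp ε) := by
  have h1 : LipschitzWith (Real.toNNReal (1 / ε)) fun x : ℝ => x / ε := by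
    refine LipschitzWith.of_dist_le_mul fun x y => ?_
    rw [Real.coe_toNNReal _ (by positivity), Real.dist_eq, Real.dist_eq, ← sub_div, abs_div,
      abs_of_pos h0]
    exact le_of_eq (by ring)
  have h2 : ramp ε = fun x => max (-1) (min 1 (x / ε)) := funext (ramp_eq h0)
  rw [h2]
  exact (h1.const_min 1).const_max (-1)

theorem ramp_neg (h0 : 0 < ε) (x : ℝ) : ramp ε (-x) = -ramp ε x := by
  rw [ramp_eq h0, ramp_eq h0, ← neg_inj, neg_neg, ← min_neg_neg, ← max_neg_neg, neg_div, neg_neg,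
    neg_neg, max_min_distrib_left]
  simp

theorem isOddAC_of_lipschitzWith {f : ℝ → ℝ} {K : NNReal} (hf : LipschitzWith K f)
    (hodd : ∀ x, f (-x) = -f x) : IsOddAC f :=
  ⟨hf.lipschitzOnWith.absolutelyContinuousOnInterval, fun x _ => hodd x⟩

theorem abs_deriv_le_of_lipschitzWith {f : ℝ → ℝ} {L : ℝ} (hL : 0 ≤ L)
    (hf : LipschitzWith (Real.toNNReal L) f) (x : ℝ) : |deriv f x| ≤ L := by
  have := norm_deriv_le_of_lipschitz (x₀ := x) hf
  rwa [Real.coe_toNNReal _ hL] at this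

theorem deriv_ramp_of_lt_abs (h0 : 0 < ε) {x : ℝ} (hx : ε < |x|) : deriv (ramp ε) x = 0 := by
  rcases lt_abs.1 hx with h | h
  · have : ramp ε =ᶠ[nhds x] fun _ => 1 := by
      filter_upwards [lt_mem_nhds h] with y hy
      rw [ramp, if_neg (by linarith), if_neg (by linarith)]
    rw [this.deriv_eq, deriv_const]
  · have : ramp ε =ᶠ[nhds x] fun _ => -1 := by
      filter_upwards [gt_mem_nhds (show x < -ε by linarith)] with y hy
      rw [ramp, if_pos hy]
    rw [this.deriv_eq, deriv_const]

theorem ramp_mem_energyBall (h0 : 0 < ε) (h1 : ε < 1 / 2) : ramp ε ∈ energyBall (dens ε) 2 := by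
  have hb : ∀ t, deriv (ramp ε) t ^ 2 * dens ε t ^ 2 ≤ (Icc (-ε) ε).indicator (fun _ => ε⁻¹) t := by
    intro t
    by_cases h : |t| ≤ ε
    · rw [indicator_of_mem (mem_Icc.2 (abs_le.1 h)), dens, if_pos h, densB_sq h0]
      have h2 := abs_deriv_le_of_lipschitzWith (by positivity) (lipschitzWith_ramp h0) t
      have h3 : deriv (ramp ε) t ^ 2 ≤ (1 / ε) ^ 2 := by
        rw [← sq_abs]; gcongr
      calc _ ≤ (1 / ε) ^ 2 * ε := by gcongr
        _ = ε⁻¹ := by field_simp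
    · rw [indicator_of_notMem (fun h2 => h (abs_le.2 (mem_Icc.1 h2))),
        deriv_ramp_of_lt_abs h0 (not_le.1 h)]
      simp
  have hi : Integrable ((Icc (-ε) ε).indicator fun _ => ε⁻¹) volIcc :=
    (integrable_const _).indicator measurableSet_Icc
  have hi2 : Integrable (fun t => deriv (ramp ε) t ^ 2 * dens ε t ^ 2) volIcc := by
    refine hi.mono' (((measurable_deriv _).pow_const 2).mul
      (measurable_dens.pow_const 2)).aestronglyMeasurable
      (Filter.Eventually.of_forall fun t => ?_)
    rw [Real.norm_of_nonneg (by positivity)]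
    exact hb t
  refine ⟨isOddAC_of_lipschitzWith (lipschitzWith_ramp h0) (ramp_neg h0), hi2, ?_⟩
  calc _ ≤ ∫ t, (Icc (-ε) ε).indicator (fun _ => ε⁻¹) t ∂volIcc := integral_mono hi2 hi hb
    _ = 2 := by rw [integral_indicator_const_volIcc h0 h1]; field_simp
    _ ≤ 2 ^ 2 := by norm_num

/-! ### The Lipschitz ball -/

theorem ae_abs_deriv_le_of_mem_lipBall {f : ℝ → ℝ} (hf : f ∈ lipBall ε) :
    ∀ᵐ t ∂volIcc, |deriv f t| ≤ 1 / ε := by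
  obtain ⟨⟨-, hfin⟩, hle⟩ := hf
  filter_upwards [enorm_ae_le_eLpNormEssSup (deriv f) volIcc] with t ht
  rw [← eLpNorm_exponent_top] at ht
  have h1 := ENNReal.toReal_mono hfin.ne ht
  rw [toReal_enorm, Real.norm_eq_abs] at h1
  exact h1.trans hle

theorem mem_lipBall_of_lipschitzWith (h0 : 0 < ε) {f : ℝ → ℝ}
    (hf : LipschitzWith (Real.toNNReal (1 / ε)) f) (hodd : ∀ x, f (-x) = -f x) :
    f ∈ lipBall ε := by
  have h : lipENorm f ≤ ENNReal.ofReal (1 / ε) := by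
    rw [lipENorm, eLpNorm_exponent_top]
    refine eLpNormEssSup_le_of_ae_bound (Filter.Eventually.of_forall fun t => ?_)
    exact abs_deriv_le_of_lipschitzWith (by positivity) hf t
  refine ⟨⟨isOddAC_of_lipschitzWith hf hodd, h.trans_lt ENNReal.ofReal_lt_top⟩, ?_⟩
  exact ENNReal.toReal_le_of_le_ofReal (by positivity) h

/-- Bounded slope implies bounded energy for the constant weight. -/
theorem lipBall_subset_energyBall :
    lipBall ε ⊆ energyBall (fun _ => 1) (√2 / ε) := by
  intro f hf
  have hb : ∀ᵐ t ∂volIcc, deriv f t ^ 2 * 1 ^ 2 ≤ (1 / ε) ^ 2 := by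
    filter_upwards [ae_abs_deriv_le_of_mem_lipBall hf] with t ht
    rw [one_pow, mul_one, ← sq_abs]
    gcongr
  have hi : Integrable (fun t => deriv f t ^ 2 * 1 ^ 2) volIcc := by
    refine (integrable_const ((1 / ε) ^ 2)).mono'
      (((measurable_deriv f).pow_const 2).mul_const _).aestronglyMeasurable ?_
    filter_upwards [hb] with t ht
    rwa [Real.norm_of_nonneg (by positivity)]
  refine ⟨hf.1.1, hi, ?_⟩
  calc _ ≤ ∫ _t, (1 / ε) ^ 2 ∂volIcc := integral_mono_ae hi (integrable_const _) hb
    _ = (√2 / ε) ^ 2 := by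
      rw [div_pow √2, Real.sq_sqrt (by norm_num)]
      simp
      ring_nf

theorem abs_sub_le_of_mem_lipBall {f : ℝ → ℝ} (hf : f ∈ lipBall ε) {x y : ℝ}
    (hx : x ∈ Icc (-1 : ℝ) 1) (hy : y ∈ Icc (-1 : ℝ) 1) : |f x - f y| ≤ 1 / ε * |x - y| := by
  have hsub : uIcc y x ⊆ Icc (-1 : ℝ) 1 := uIcc_subset_Icc hy hx
  have hac : AbsolutelyContinuousOnInterval f y x :=
    hf.1.1.1.mono (by rwa [uIcc_of_le (by norm_num : (-1 : ℝ) ≤ 1)])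
  rw [← hac.integral_deriv_eq_sub, ← Real.norm_eq_abs]
  refine intervalIntegral.norm_integral_le_of_norm_le_const_ae ?_
  filter_upwards [(ae_restrict_iff' measurableSet_Icc).1 (ae_abs_deriv_le_of_mem_lipBall hf)]
    with t ht htx
  exact ht (hsub (uIoc_subset_uIcc htx))

/-- Finite Lipschitz data extend to the line. -/
theorem exists_lipschitzWith_interpolant {ι : Type*} {z w : ι → ℝ} {K : NNReal}
    (h : ∀ a b, |w a - w b| ≤ K * |z a - z b|) :
    ∃ F : ℝ → ℝ, LipschitzWith K F ∧ ∀ a, F (z a) = w a := by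
  have hfac : w.FactorsThrough z := by
    intro a b hab
    have := h a b
    rw [hab, sub_self, abs_zero, mul_zero] at this
    exact sub_eq_zero.1 (abs_nonpos_iff.1 this)
  have hv : ∀ a, Function.extend z w 0 (z a) = w a := fun a => hfac.extend_apply 0 a
  have hL : LipschitzOnWith K (Function.extend z w 0) (range z) := by
    refine LipschitzOnWith.of_dist_le_mul ?_
    rintro _ ⟨a, rfl⟩ _ ⟨b, rfl⟩
    rw [hv, hv]
    exact h a b
  obtain ⟨F, hF, hFe⟩ := hL.extend_real
  exact ⟨F, hF, fun a => by rw [← hFe (mem_range_self a), hv]⟩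

/-- The value vectors of the Lipschitz ball at given points are cut out by finitely many closed
conditions, by extension of Lipschitz functions followed by antisymmetrization. -/
theorem values_lipBall_eq (h0 : 0 < ε) {n : ℕ} {x : Fin n → ℝ}
    (hx : ∀ i, x i ∈ Icc (-1 : ℝ) 1) :
    (fun (f : ℝ → ℝ) (i : Fin n) => f (x i)) '' lipBall ε
      = {v | ∀ i j, |v i - v j| ≤ 1 / ε * |x i - x j| ∧ |v i + v j| ≤ 1 / ε * |x i + x j|} := by
  have hnx : ∀ i, -(x i) ∈ Icc (-1 : ℝ) 1 := fun i =>
    ⟨by linarith [(hx i).2], by linarith [(hx i).1]⟩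
  ext v
  constructor
  · rintro ⟨f, hf, rfl⟩ i j
    refine ⟨abs_sub_le_of_mem_lipBall hf (hx i) (hx j), ?_⟩
    have := abs_sub_le_of_mem_lipBall hf (hx i) (hnx j)
    rwa [hf.1.1.2 _ (hx j), sub_neg_eq_add, sub_neg_eq_add] at this
  · intro hv
    have hK : ((Real.toNNReal (1 / ε) : NNReal) : ℝ) = 1 / ε := Real.coe_toNNReal _ (by positivity)
    obtain ⟨F, hF, hFv⟩ := exists_lipschitzWith_interpolant (K := Real.toNNReal (1 / ε))
      (z := Sum.elim x fun i => -(x i)) (w := Sum.elim v fun i => -(v i)) (by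
        rw [hK]
        rintro (i | i) (j | j)
        · exact (hv i j).1
        · simpa [sub_neg_eq_add] using (hv i j).2
        · have := (hv i j).2
          rw [← abs_neg, ← abs_neg (x i + x j)] at this
          simpa [neg_add, sub_eq_add_neg, add_comm] using this
        · have := (hv j i).1
          simp only [Sum.elim_inr]
          rwa [neg_sub_neg, neg_sub_neg])
    refine ⟨fun t => (F t - F (-t)) / 2, mem_lipBall_of_lipschitzWith h0 ?_ fun t => ?_, ?_⟩
    · refine LipschitzWith.of_dist_le_mul fun s t => ?_
      have h1 := hF.dist_le_mul s t
      have h2 := hF.dist_le_mul (-s) (-t)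
      rw [Real.dist_eq, Real.dist_eq] at h1 h2 ⊢
      rw [neg_sub_neg, abs_sub_comm t s] at h2
      rw [abs_le] at h1 h2 ⊢
      constructor <;> linarith [h1.1, h1.2, h2.1, h2.2]
    · simp only [neg_neg]; ring
    · funext i
      have h1 := hFv (Sum.inl i)
      have h2 := hFv (Sum.inr i)
      simp only [Sum.elim_inl, Sum.elim_inr] at h1 h2
      simp only [h1, h2]
      ring

theorem isCompact_values_lipBall (h0 : 0 < ε) {n : ℕ} {x : Fin n → ℝ}
    (hx : ∀ i, x i ∈ Icc (-1 : ℝ) 1) :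
    IsCompact ((fun (f : ℝ → ℝ) (i : Fin n) => f (x i)) '' lipBall ε) := by
  rw [values_lipBall_eq h0 hx]
  refine (isCompact_univ_pi fun _ : Fin n =>
    isCompact_Icc (a := -(1 / ε)) (b := 1 / ε)).of_isClosed_subset ?_ ?_
  · simp only [ofPred_forall, ofPred_and]
    exact isClosed_iInter fun i => isClosed_iInter fun j =>
      (isClosed_le (by fun_prop) (by fun_prop)).inter (isClosed_le (by fun_prop) (by fun_prop))
  · intro v hv i _
    have h1 := (hv i i).2
    have h2 : |x i + x i| ≤ 2 := by
      rw [abs_le]; constructor <;> linarith [(hx i).1, (hx i).2]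
    have h3 : |v i + v i| ≤ 1 / ε * 2 := h1.trans (by gcongr)
    rw [abs_le] at h3
    constructor <;> linarith [h3.1, h3.2]

end Density

/-! ### The design and the rates -/

theorem ae_mem_Icc_of_isSample {Ω : Type*} [MeasurableSpace Ω] {P : Measure Ω} {ε : ℝ}
    (h1 : ε < 1 / 2) {n : ℕ} {X ξ : Fin n → Ω → ℝ} (hS : IsSample P ε X ξ) :
    ∀ᵐ ω ∂P, ∀ i, X i ω ∈ Icc (-1 : ℝ) 1 := by
  rw [ae_all_iff]
  intro i
  have h : ∀ᵐ x ∂(designLaw ε), x ∈ Icc (-1 : ℝ) 1 := by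
    rw [designLaw, ae_withDensity_iff (measurable_dens.ennreal_ofReal)]
    refine Filter.Eventually.of_forall fun x hx => ?_
    by_contra hx'
    have h2 : ¬ |x| ≤ 1 := fun h => hx' (abs_le.1 h)
    refine hx ?_
    rw [dens, if_neg (by linarith), if_neg h2, ENNReal.ofReal_zero]
  rw [← (hS.law_design i).map_eq] at h
  exact ae_of_ae_map (hS.law_design i).aemeasurable h

/-- The solution of `t³ = A y`. -/
theorem exists_critical_radius {A y : ℝ} (hA : 0 < A) (hy : 0 < y) :
    ∃ t, 0 < t ∧ t ^ 3 = A * y ∧ t ^ 2 = A ^ (2 / 3 : ℝ) * y ^ (2 / 3 : ℝ) := by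
  refine ⟨(A * y) ^ (1 / 3 : ℝ), by positivity, ?_, ?_⟩
  · rw [← Real.rpow_natCast, ← Real.rpow_mul (by positivity)]
    norm_num
  · rw [← Real.rpow_natCast, ← Real.rpow_mul (by positivity), Real.mul_rpow hA.le hy.le]
    norm_num

theorem rpow_two_thirds_eq {y : ℝ} (hy : 0 < y) :
    y ^ (2 / 3 : ℝ) = y * y⁻¹ ^ (1 / 3 : ℝ) := by
  rw [Real.inv_rpow hy.le, ← Real.rpow_neg hy.le]
  nth_rewrite 2 [← Real.rpow_one y]
  rw [← Real.rpow_add hy]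
  norm_num

theorem theorem3 :
    ∃ c₀ c₁ c₂ c₃ : ℝ, 0 < c₀ ∧ 0 < c₁ ∧ 0 < c₂ ∧ 0 < c₃ ∧
      ∀ ε : ℝ, 0 < ε → ε < 1 / 2 → ∀ σ : ℝ, 0 < σ → ∀ n : ℕ, 0 < n →
      ∀ (Ω : Type*) [MeasurableSpace Ω] (P : Measure Ω) [IsProbabilityMeasure P]
        (X ξ : Fin n → Ω → ℝ), IsSample P ε X ξ →
        -- almost surely, both least-squares problems have a solution
        (∀ᵐ ω ∂P, ∃ f : ℝ → ℝ, IsLeastSquares (sobolevBall ε) (fun i => X i ω)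
          (response ε σ (fun i => X i ω) (fun i => ξ i ω)) f) ∧
        (∀ᵐ ω ∂P, ∃ f : ℝ → ℝ, IsLeastSquares (lipBall ε) (fun i => X i ω)
          (response ε σ (fun i => X i ω) (fun i => ξ i ω)) f) ∧
        -- the event that some solution of the first problem violates the bound
        P {ω | ∃ f : ℝ → ℝ, IsLeastSquares (sobolevBall ε) (fun i => X i ω)
              (response ε σ (fun i => X i ω) (fun i => ξ i ω)) f ∧
            c₁ * (σ ^ 2 / n) ^ (2 / 3 : ℝ) <
              empNormSq (fun i => X i ω) (fun x => f x - ramp ε x)}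
          ≤ ENNReal.ofReal (Real.exp (-c₀ * (n / σ ^ 2) ^ (1 / 3 : ℝ))) ∧
        -- the event that some solution of the second problem violates the bound
        P {ω | ∃ f : ℝ → ℝ, IsLeastSquares (lipBall ε) (fun i => X i ω)
              (response ε σ (fun i => X i ω) (fun i => ξ i ω)) f ∧
            c₃ * (σ ^ 2 / (ε * n)) ^ (2 / 3 : ℝ) <
              empNormSq (fun i => X i ω) (fun x => f x - ramp ε x)}
          ≤ ENNReal.ofReal (Real.exp (-c₂ * (ε ^ 2 * (n / σ ^ 2)) ^ (1 / 3 : ℝ))) := by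
  -- `t³ = 512 B σ² / n` with the sup-norm bounds `B = 24` and `B = 4 / ε` for differences in the
  -- two classes; the divisor `256` is that of the tail `exp (-n t² / (256 σ²))`
  refine ⟨12288 ^ (2 / 3 : ℝ) / 256, 12288 ^ (2 / 3 : ℝ), 2048 ^ (2 / 3 : ℝ) / 256,
    2048 ^ (2 / 3 : ℝ), by positivity, by positivity, by positivity, by positivity, ?_⟩
  intro ε h0 h1 σ hσ n hn Ω _ P _ X ξ hS
  have hn' : (0 : ℝ) < n := by exact_mod_cast hn
  have hX := ae_mem_Icc_of_isSample h1 hS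
  have hp := memLp_inv_dens h0 h1
  have hp0 : ∀ x ∈ Icc (-1 : ℝ) 1, dens ε x ≠ 0 := fun x hx =>
    ((min_densB_pos h0).trans_le (min_le_dens h0 h1 hx)).ne'
  have hrampL : ramp ε ∈ lipBall ε :=
    mem_lipBall_of_lipschitzWith h0 (lipschitzWith_ramp h0) (ramp_neg h0)
  refine ⟨?_, ?_, ?_, ?_⟩
  · filter_upwards [hX] with ω hω
    rw [sobolevBall_eq_energyBall]
    exact exists_isLeastSquares_of_isCompact
      (isCompact_values_energyBall hp measurable_dens dens_neg hp0 (by norm_num) hω)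
      ⟨_, ramp_mem_energyBall h0 h1⟩ _
  · filter_upwards [hX] with ω hω
    exact exists_isLeastSquares_of_isCompact (isCompact_values_lipBall h0 hω) ⟨_, hrampL⟩ _
  · have hy : 0 < σ ^ 2 / (n : ℝ) := by positivity
    obtain ⟨t, ht, ht3, ht2⟩ := exists_critical_radius (A := 12288) (by norm_num) hy
    have hL := integral_inv_dens_sq_le h0 h1
    rw [← ht2, sobolevBall_eq_energyBall]
    refine (measure_isLeastSquares_le (L := 34) (R := 2) (B := 24) hn (by norm_num)
      (evalScale_mem_Icc hp hL) (continuous_evalVec hp)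
      (fun x y => (norm_evalVec_sub_sq hp x y).le) (norm_evalVec_sq_le hp hL) (by norm_num)
      (by norm_num) (by norm_num) ht hσ ?_
      (fun f hf => exists_inner_evalVec_of_mem_energyBall hp measurable_dens hp0 (by norm_num) hf)
      (ramp_mem_energyBall h0 h1) hS hX).trans (le_of_eq ?_)
    · rw [ht3]
      apply le_of_eq
      field_simp
      norm_num
    · rw [ht2, rpow_two_thirds_eq hy, inv_div]
      congr 2
      field_simp
  · have hy : 0 < σ ^ 2 / (ε * n) := by positivity
    obtain ⟨t, ht, ht3, ht2⟩ := exists_critical_radius (A := 2048) (by norm_num) hy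
    have hp1 : MemLp (fun _ : ℝ => (1 : ℝ)⁻¹) 2 volIcc :=
      memLp_inv_of_le measurable_const one_pos fun _ _ => le_rfl
    have hL : ∫ _t, (1 : ℝ)⁻¹ ^ 2 ∂volIcc ≤ 2 := by
      simp
      norm_num
    rw [← ht2]
    refine (measure_isLeastSquares_le (L := 2) (R := √2 / ε) (B := 4 / ε) hn (by norm_num)
      (evalScale_mem_Icc hp1 hL) (continuous_evalVec hp1)
      (fun x y => (norm_evalVec_sub_sq hp1 x y).le) (norm_evalVec_sq_le hp1 hL) (by positivity)
      (by positivity) ?_ ht hσ ?_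
      (fun f hf => exists_inner_evalVec_of_mem_energyBall hp1 measurable_const
        (fun _ _ => one_ne_zero) (by positivity) (lipBall_subset_energyBall hf))
      hrampL hS hX).trans (ENNReal.ofReal_le_ofReal (Real.exp_le_exp.2 ?_))
    · rw [mul_pow, div_pow √2, Real.sq_sqrt (by norm_num)]
      apply le_of_eq
      field_simp
      norm_num
    · rw [ht3]
      apply le_of_eq
      field_simp
      norm_num
    · rw [ht2, rpow_two_thirds_eq hy, inv_div, neg_mul, neg_le_neg_iff]
      have h2 : (ε ^ 2 * (n / σ ^ 2)) ^ (1 / 3 : ℝ) ≤ (ε * n / σ ^ 2) ^ (1 / 3 : ℝ) := by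
        refine Real.rpow_le_rpow (by positivity) ?_ (by norm_num)
        rw [mul_div_assoc]
        gcongr
        nlinarith
      have h3 : n * (2048 ^ (2 / 3 : ℝ) * (σ ^ 2 / (ε * n) * (ε * n / σ ^ 2) ^ (1 / 3 : ℝ)))
          / (256 * σ ^ 2) = 2048 ^ (2 / 3 : ℝ) / 256 * (ε⁻¹ * (ε * n / σ ^ 2) ^ (1 / 3 : ℝ)) := by
        field_simp
      rw [h3]
      have h4 : 1 ≤ ε⁻¹ := (one_le_inv₀ h0).2 (by linarith)
      gcongr
      exact h2.trans (le_mul_of_one_le_left (by positivity) h4)
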